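/- \textbf{Setting.} Let $\mathcal S,\mathcal A$ be finite sets of sizes $S,A\ge 1$ and $H$ a horizon. For a parameter $\theta$ in a measurable space $\Theta$ let $\mathcal M(\theta)$ be the episodic MDP with transition probabilities $P^\theta_h(s'\mid s,a)$, $0\le h<H$ (measurable in $\theta$), known rewards $r_h(s,a)\in[0,1]$ for $h<H$, known terminal reward $r_H(s)\in[0,1]$, and known initial distribution $\nu$. Let $V^*_h(s;\theta)$, $Q^*_h(s,a;\theta)$ be the optimal values, given by $V_H^*=r_H$, $Q^*_h(s,a;\theta)=r_h(s,a)+\sum_{s'}P_h^\theta(s'\mid s,a)V^*_{h+1}(s';\theta)$ and $V^*_h(s;\theta)=\max_aQ^*_h(s,a;\theta)$. A policy assigns to each period $h<H$ and state $s$ a probability distribution on $\mathcal A$; it is optimal for $\theta$ if it maximizes the expected total reward $\mathbb E\big[\sum_{h<H}r_h(s_h,a_h)+r_H(s_H)\big]$ of an episode of $\mathcal M(\theta)$ started from $s_0\sim\nu$. Fix a measurable rule $\theta\mapsto\pi^*(\theta)$ that selects an optimal policy for each $\theta$. \textbf{Algorithm (iPSRL).} The true parameter $\theta^*$ is drawn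 from a prior $\mu_0$ on $\Theta$. Given $\theta^*$, an offline dataset $\mathcal D_0$ of $L\ge 0$ independent episodes of $\mathcal M(\theta^*)$ is generated by an expert who uses the policy $\pi^\beta_h(a\mid s)\propto\exp(\beta Q_h^*(s,a;\theta^*))$, where $\beta\ge 0$ is known. In each online episode $t=1,\dots,T$ the learner computes the posterior distribution $\mu_t$ of $\theta^*$ given $\mathcal D_0$ and the first $t-1$ online episodes by Bayes' rule, samples $\tilde\theta_t\sim\mu_t$, and plays the policy $\tilde\pi^t=\pi^*(\tilde\theta_t)$ in $\mathcal M(\theta^*)$, which yields the states and actions $s^t_0,a^t_0,\dots,s^t_H$. The Bayesian regret is $$\mathfrak{BR}_T=\mathbb E\Big[\sum_{t=1}^T\Big(V_0^*(s_0^t;\theta^*)-\sum_{h=0}^{H-1}r_h(s_h^t,a_h^t)-r_H(s_H^t)\Big)\Big].$$ \textbf{Statement.} Let $\varepsilon=\Pr(\tilde\pi^1\ne\pi^*(\theta^*))$ be the probability that the policy used in the first online episode differs from the selected optimal policy of the true MDP. Then $$\mathfrak{BR}_T=O\big(\sqrt{\varepsilon H^4S^2AT}\,(1+\log T)\big):$$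 there is a universal constant $C>0$ such that, for all $\Theta,\mathcal S,\mathcal A,H$, all such families of MDPs, all priors $\mu_0$, all selections $\pi^*$, all $\beta\ge0$, $L\ge0$ and $T\ge1$, the regret inside the expectation is integrable and $$|\mathfrak{BR}_T|\le C\sqrt{\varepsilon H^4S^2AT}\,(1+\log T).$$ -/

import Mathlib

open MeasureTheory ProbabilityTheory

set_option linter.unusedSectionVars false

noncomputable section

namespace IPSRL

/-- The record of one episode: the states `s_0, …, s_H` and the actions `a_0, …, a_{H-1}`. -/
structure Episode (S A : Type*) (H : ℕ) where
  state : Fin (H + 1) → S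
  action : Fin H → A

/-- An episode as a pair (states, actions). -/
def Episode.equivProd (S A : Type*) (H : ℕ) :
    ((Fin (H + 1) → S) × (Fin H → A)) ≃ Episode S A H where
  toFun x := ⟨x.1, x.2⟩
  invFun e := (e.state, e.action)
  left_inv _ := rfl
  right_inv _ := rfl

instance (S A : Type*) [Fintype S] [Fintype A] (H : ℕ) : Fintype (Episode S A H) := by
  classical exact Fintype.ofEquiv _ (Episode.equivProd S A H)

/-- Episodes range over a finite set, with the discrete σ-algebra. -/
instance (S A : Type*) (H : ℕ) : MeasurableSpace (Episode S A H) := ⊤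

instance (S A : Type*) (H : ℕ) : DiscreteMeasurableSpace (Episode S A H) := ⟨fun _ => trivial⟩

/-- A (randomized, time-dependent, Markov) policy: for each period and state, a probability
vector on the actions. -/
abbrev Policy (S A : Type*) [Fintype A] (H : ℕ) := Fin H → S → stdSimplex ℝ A

/-- A family of episodic MDPs with horizon `H`, state space `S`, action space `A`, indexed by the
unknown parameter `θ : Θ`. Only the transition probabilities `P θ` depend on `θ`; the rewards
`r h` (periods `h < H`), the terminal reward `rEnd` (period `H`), and the initial distribution `ν`
are known. All rewards lie in `[0, 1]`. -/
structure MDPFamily (Θ S A : Type*) [MeasurableSpace Θ] [Fintype S] (H : ℕ) where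
  P : Θ → Fin H → S → A → stdSimplex ℝ S
  r : Fin H → S → A → ℝ
  rEnd : S → ℝ
  ν : stdSimplex ℝ S
  measurable_P : Measurable P
  r_mem : ∀ h s a, r h s a ∈ Set.Icc (0 : ℝ) 1
  rEnd_mem : ∀ s, rEnd s ∈ Set.Icc (0 : ℝ) 1

/-- The finitely supported measure with weights `w x e`, as a kernel in `x`. -/
def finKernel {X E : Type*} [MeasurableSpace X] [MeasurableSpace E] [Fintype E]
    (w : X → E → ℝ) (hw : ∀ e, Measurable fun x => w x e) : Kernel X E where
  toFun x := ∑ e, ENNReal.ofReal (w x e) • Measure.dirac e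
  measurable' := by
    refine Measure.measurable_of_measurable_coe _ fun s _ => ?_
    simp only [Measure.coe_finsetSum, Finset.sum_apply, Measure.smul_apply, smul_eq_mul]
    exact Finset.measurable_sum _ fun e _ => ((hw e).ennreal_ofReal).mul_const _

theorem finKernel_isMarkovKernel {X E : Type*} [MeasurableSpace X] [MeasurableSpace E] [Fintype E]
    (w : X → E → ℝ) (hw : ∀ e, Measurable fun x => w x e) (h0 : ∀ x e, 0 ≤ w x e)
    (h1 : ∀ x, ∑ e, w x e = 1) : IsMarkovKernel (finKernel w hw) := by
  refine ⟨fun x => ⟨?_⟩⟩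
  change (∑ e, ENNReal.ofReal (w x e) • Measure.dirac e : Measure E) Set.univ = 1
  simp only [Measure.coe_finsetSum, Finset.sum_apply, Measure.smul_apply, smul_eq_mul,
    measure_univ, mul_one]
  rw [← ENNReal.ofReal_sum_of_nonneg fun e _ => h0 x e, h1 x, ENNReal.ofReal_one]

theorem sum_path {S A : Type*} [Fintype S] [Fintype A] (ν : S → ℝ) (H : ℕ)
    (w : Fin H → S → A → S → ℝ) (hw : ∀ h s, ∑ a, ∑ s', w h s a s' = 1) :
    ∑ e : Episode S A H,
      ν (e.state 0) * ∏ h : Fin H, w h (e.state h.castSucc) (e.action h) (e.state h.succ)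
      = ∑ s, ν s := by
  rw [← (Episode.equivProd S A H).sum_comp, Fintype.sum_prod_type]
  simp only [Episode.equivProd, Equiv.coe_fn_mk]
  induction H with
  | zero =>
    rw [← (Equiv.funUnique (Fin 1) S).symm.sum_comp]
    simp [Equiv.funUnique]
  | succ n ih =>
    rw [← (Fin.snocEquiv fun _ : Fin (n + 2) => S).sum_comp, Fintype.sum_prod_type_right]
    rw [← ih (fun h => w h.castSucc) (fun h s => hw h.castSucc s)]
    refine Finset.sum_congr rfl fun x _ => ?_
    have key : ∀ (y : S),
        ∑ a : Fin (n + 1) → A, ν (Fin.snocEquiv (fun _ : Fin (n + 2) => S) (y, x) 0) *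
          ∏ h : Fin (n + 1), w h (Fin.snocEquiv (fun _ : Fin (n + 2) => S) (y, x) h.castSucc) (a h)
            (Fin.snocEquiv (fun _ : Fin (n + 2) => S) (y, x) h.succ)
        = ∑ b : Fin n → A, ∑ c : A, (ν (x 0) *
          ∏ h : Fin n, w h.castSucc (x h.castSucc) (b h) (x h.succ)) *
            w (Fin.last n) (x (Fin.last n)) c y := by
      intro y
      rw [← (Fin.snocEquiv fun _ : Fin (n + 1) => A).sum_comp, Fintype.sum_prod_type_right]
      refine Finset.sum_congr rfl fun b _ => Finset.sum_congr rfl fun c _ => ?_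
      rw [Fin.prod_univ_castSucc, ← mul_assoc]
      have h0 : (0 : Fin (n + 2)) = Fin.castSucc 0 := rfl
      simp only [Fin.snocEquiv, Equiv.coe_fn_mk, Fin.snoc_castSucc, Fin.succ_last, Fin.snoc_last,
        h0, Fin.succ_castSucc]
    simp only [key]
    rw [Finset.sum_comm]
    refine Finset.sum_congr rfl fun b _ => ?_
    simp only [← Finset.mul_sum]
    rw [Finset.sum_comm, hw, mul_one]

namespace MDPFamily

variable {Θ S A : Type*} [MeasurableSpace Θ] [Fintype S] [Fintype A] {H : ℕ}

/-- The probability of the episode `e` when policy `π` is followed in the MDP with parameter `θ`. -/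
def episodeProb (M : MDPFamily Θ S A H) (θ : Θ) (π : Policy S A H) (e : Episode S A H) : ℝ :=
  M.ν.1 (e.state 0) * ∏ h : Fin H, ((π h (e.state h.castSucc)).1 (e.action h) *
    (M.P θ h (e.state h.castSucc) (e.action h)).1 (e.state h.succ))

theorem episodeProb_nonneg (M : MDPFamily Θ S A H) (θ : Θ) (π : Policy S A H)
    (e : Episode S A H) : 0 ≤ M.episodeProb θ π e :=
  mul_nonneg (M.ν.2.1 _) (Finset.prod_nonneg fun _ _ => mul_nonneg ((π _ _).2.1 _)
    ((M.P _ _ _ _).2.1 _))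

theorem sum_episodeProb (M : MDPFamily Θ S A H) (θ : Θ) (π : Policy S A H) :
    ∑ e, M.episodeProb θ π e = 1 := by
  have h := sum_path (A := A) M.ν.1 H
    (fun h s a s' => (π h s).1 a * (M.P θ h s a).1 s') (fun h s => by
      simp only [← Finset.mul_sum, (M.P θ h s _).2.2, mul_one, (π h s).2.2])
  rw [M.ν.2.2] at h
  exact h

theorem measurable_P_apply (M : MDPFamily Θ S A H) (h : Fin H) (s : S) (a : A) (s' : S) :
    Measurable fun θ => (M.P θ h s a).1 s' := by
  have h1 := measurable_pi_iff.1 (measurable_pi_iff.1 (measurable_pi_iff.1 M.measurable_P h) s) a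
  exact measurable_pi_iff.1 (measurable_subtype_coe.comp h1) s'

theorem measurable_episodeProb {X : Type*} [MeasurableSpace X] (M : MDPFamily Θ S A H)
    {f : X → Θ} (hf : Measurable f) {g : X → Policy S A H} (hg : Measurable g)
    (e : Episode S A H) : Measurable fun x => M.episodeProb (f x) (g x) e := by
  refine measurable_const.mul (Finset.measurable_prod _ fun h _ => Measurable.mul ?_ ?_)
  · have h1 := measurable_pi_iff.1 (measurable_pi_iff.1 hg h) (e.state h.castSucc)
    exact measurable_pi_iff.1 (measurable_subtype_coe.comp h1) _
  · exact (M.measurable_P_apply _ _ _ _).comp hf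

/-- The total reward `∑_{h<H} r_h(s_h, a_h) + r_H(s_H)` collected in an episode. -/
def totalReward (M : MDPFamily Θ S A H) (e : Episode S A H) : ℝ :=
  ∑ h : Fin H, M.r h (e.state h.castSucc) (e.action h) + M.rEnd (e.state (Fin.last H))

/-- The expected total reward of policy `π` in the MDP with parameter `θ`. -/
def expReturn (M : MDPFamily Θ S A H) (θ : Θ) (π : Policy S A H) : ℝ :=
  ∑ e, M.episodeProb θ π e * M.totalReward e

/-- `π` is optimal in the MDP with parameter `θ`: it maximizes the expected total reward. -/
def IsOptimal (M : MDPFamily Θ S A H) (θ : Θ) (π : Policy S A H) : Prop :=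
  ∀ π' : Policy S A H, M.expReturn θ π' ≤ M.expReturn θ π

/-- A fixed measurable rule `θ ↦ π*(θ)` that picks, for each parameter, one optimal policy
(that is, a planning algorithm with a fixed way of breaking ties). -/
structure OptimalSelection (M : MDPFamily Θ S A H) where
  policy : Θ → Policy S A H
  measurable_policy : Measurable policy
  isOptimal : ∀ θ, M.IsOptimal θ (policy θ)

/-- The optimal values `V*_h(s; θ)`, `h = 0, …, H`, by backward induction on the Bellman equation,
starting from `V*_H = r_H`. -/
def optV [Nonempty A] (M : MDPFamily Θ S A H) (θ : Θ) : Fin (H + 1) → S → ℝ :=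
  fun h => Fin.reverseInduction (motive := fun _ => S → ℝ) M.rEnd
    (fun h V s => Finset.univ.sup' Finset.univ_nonempty fun a : A =>
      M.r h s a + ∑ s', (M.P θ h s a).1 s' * V s') h

/-- The optimal state-action values `Q*_h(s, a; θ)`. -/
def optQ [Nonempty A] (M : MDPFamily Θ S A H) (θ : Θ) (h : Fin H) (s : S) (a : A) : ℝ :=
  M.r h s a + ∑ s', (M.P θ h s a).1 s' * M.optV θ h.succ s'

theorem optV_last [Nonempty A] (M : MDPFamily Θ S A H) (θ : Θ) (s : S) :
    M.optV θ (Fin.last H) s = M.rEnd s := by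
  simp [optV]

theorem optV_castSucc [Nonempty A] (M : MDPFamily Θ S A H) (θ : Θ) (h : Fin H) (s : S) :
    M.optV θ h.castSucc s = Finset.univ.sup' Finset.univ_nonempty (M.optQ θ h s) := by
  simp only [optV, Fin.reverseInduction_castSucc]
  rfl

theorem measurable_optV [Nonempty A] (M : MDPFamily Θ S A H) (h : Fin (H + 1)) :
    ∀ s, Measurable fun θ => M.optV θ h s := by
  induction h using Fin.reverseInduction with
  | last => intro s; simp only [optV_last]; exact measurable_const
  | cast h ih =>
    intro s
    simp only [optV_castSucc]
    have : (fun θ => Finset.univ.sup' Finset.univ_nonempty (M.optQ θ h s))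
        = Finset.univ.sup' Finset.univ_nonempty fun a θ => M.optQ θ h s a := by
      ext θ; simp
    rw [this]
    refine Finset.measurable_sup' _ fun a _ => ?_
    exact measurable_const.add (Finset.measurable_sum _ fun s' _ =>
      (M.measurable_P_apply _ _ _ _).mul (ih s'))

theorem measurable_optQ [Nonempty A] (M : MDPFamily Θ S A H) (h : Fin H) (s : S) (a : A) :
    Measurable fun θ => M.optQ θ h s a :=
  measurable_const.add (Finset.measurable_sum _ fun s' _ =>
    (M.measurable_P_apply _ _ _ _).mul (M.measurable_optV _ s'))

/-- The expert's policy: softmax of the optimal state-action values, with deliberateness `β`. -/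
def expertPolicy [Nonempty A] (M : MDPFamily Θ S A H) (β : ℝ) (θ : Θ) : Policy S A H :=
  fun h s => ⟨fun a => Real.exp (β * M.optQ θ h s a) / ∑ b, Real.exp (β * M.optQ θ h s b),
    fun _ => by positivity, by
      rw [← Finset.sum_div]
      exact div_self (Finset.sum_pos (fun _ _ => Real.exp_pos _) Finset.univ_nonempty).ne'⟩

theorem measurable_expertPolicy [Nonempty A] (M : MDPFamily Θ S A H) (β : ℝ) :
    Measurable (M.expertPolicy β) := by
  refine measurable_pi_iff.2 fun h => measurable_pi_iff.2 fun s => Measurable.subtype_mk ?_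
  refine measurable_pi_iff.2 fun a => Measurable.div ?_ (Finset.measurable_sum _ fun b _ => ?_)
  all_goals exact Real.measurable_exp.comp ((M.measurable_optQ _ _ _).const_mul _)

/-- Given `θ`, the probability of the offline dataset `D₀`: its `L` episodes are independent and
generated by the expert. -/
def offlineProb [Nonempty A] (M : MDPFamily Θ S A H) (β : ℝ) {L : ℕ} (θ : Θ)
    (D₀ : Fin L → Episode S A H) : ℝ :=
  ∏ l, M.episodeProb θ (M.expertPolicy β θ) (D₀ l)

theorem measurable_offlineProb [Nonempty A] (M : MDPFamily Θ S A H) (β : ℝ) {L : ℕ}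
    (D₀ : Fin L → Episode S A H) : Measurable fun θ => M.offlineProb β θ D₀ :=
  Finset.measurable_prod _ fun _ _ =>
    M.measurable_episodeProb measurable_id (M.measurable_expertPolicy β) _

/-- The law of the offline dataset given `θ`. -/
def offlineKernel [Nonempty A] (M : MDPFamily Θ S A H) (β : ℝ) (L : ℕ) :
    Kernel Θ (Fin L → Episode S A H) :=
  finKernel (fun θ D₀ => M.offlineProb β θ D₀) (M.measurable_offlineProb β)

instance [Nonempty A] (M : MDPFamily Θ S A H) (β : ℝ) (L : ℕ) :
    IsMarkovKernel (M.offlineKernel β L) := by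
  refine finKernel_isMarkovKernel _ _
    (fun θ D₀ => Finset.prod_nonneg fun _ _ => M.episodeProb_nonneg _ _ _) fun θ => ?_
  have h := Finset.prod_univ_sum (fun _ : Fin L => (Finset.univ : Finset (Episode S A H)))
    (fun _ e => M.episodeProb θ (M.expertPolicy β θ) e)
  rw [Fintype.piFinset_univ] at h
  exact h.symm.trans (by simp [M.sum_episodeProb])

/-- The likelihood of `θ` given the offline dataset `D₀` and the online episodes `E`. The initial
distribution and the learner's action probabilities in the online episodes do not depend on the
true parameter, so for `E` only the transition probabilities are kept. -/
def likelihood [Nonempty A] (M : MDPFamily Θ S A H) (β : ℝ) {L t : ℕ}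
    (D₀ : Fin L → Episode S A H) (E : Fin t → Episode S A H) (θ : Θ) : ℝ :=
  M.offlineProb β θ D₀ * ∏ j, ∏ h : Fin H,
    (M.P θ h ((E j).state h.castSucc) ((E j).action h)).1 ((E j).state h.succ)

/-- The posterior on `Θ` given the offline dataset and `t` online episodes, by Bayes' rule from
the prior `μ₀`. Data of marginal likelihood zero (which never occur) get the value `μ₀`. -/
def posterior [Nonempty A] (M : MDPFamily Θ S A H) (β : ℝ) (μ₀ : Measure Θ) {L t : ℕ}
    (D₀ : Fin L → Episode S A H) (E : Fin t → Episode S A H) : Measure Θ :=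
  open scoped Classical in
  if ∫⁻ θ, ENNReal.ofReal (M.likelihood β D₀ E θ) ∂μ₀ = 0 then μ₀
  else (∫⁻ θ, ENNReal.ofReal (M.likelihood β D₀ E θ) ∂μ₀)⁻¹ •
    μ₀.withDensity fun θ => ENNReal.ofReal (M.likelihood β D₀ E θ)

theorem likelihood_le_one [Nonempty A] (M : MDPFamily Θ S A H) (β : ℝ) {L t : ℕ}
    (D₀ : Fin L → Episode S A H) (E : Fin t → Episode S A H) (θ : Θ) :
    M.likelihood β D₀ E θ ≤ 1 := by
  have h1 : ∀ e : Episode S A H, M.episodeProb θ (M.expertPolicy β θ) e ≤ 1 := fun e =>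
    (Finset.single_le_sum (fun e _ => M.episodeProb_nonneg θ (M.expertPolicy β θ) e)
      (Finset.mem_univ e)).trans (M.sum_episodeProb θ _).le
  have h2 : ∀ (h : Fin H) s a s', (M.P θ h s a).1 s' ≤ 1 := fun h s a s' =>
    (Finset.single_le_sum (fun x _ => (M.P θ h s a).2.1 x) (Finset.mem_univ s')).trans
      (M.P θ h s a).2.2.le
  have h3 : ∏ j, ∏ h : Fin H,
      (M.P θ h ((E j).state h.castSucc) ((E j).action h)).1 ((E j).state h.succ) ≤ 1 :=
    Finset.prod_le_one (fun _ _ => Finset.prod_nonneg fun _ _ => (M.P _ _ _ _).2.1 _)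
      fun _ _ => Finset.prod_le_one (fun _ _ => (M.P _ _ _ _).2.1 _) fun _ _ => h2 _ _ _ _
  exact mul_le_one₀ (Finset.prod_le_one (fun _ _ => M.episodeProb_nonneg _ _ _) fun _ _ => h1 _)
    (Finset.prod_nonneg fun _ _ => Finset.prod_nonneg fun _ _ => (M.P _ _ _ _).2.1 _) h3

instance [Nonempty A] (M : MDPFamily Θ S A H) (β : ℝ) (μ₀ : Measure Θ) [IsProbabilityMeasure μ₀]
    {L t : ℕ} (D₀ : Fin L → Episode S A H) (E : Fin t → Episode S A H) :
    IsProbabilityMeasure (M.posterior β μ₀ D₀ E) := by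
  unfold posterior
  split_ifs with h
  · infer_instance
  · refine ⟨?_⟩
    rw [Measure.smul_apply, withDensity_apply _ MeasurableSet.univ, Measure.restrict_univ,
      smul_eq_mul]
    refine ENNReal.inv_mul_cancel h (ne_of_lt ?_)
    calc ∫⁻ θ, ENNReal.ofReal (M.likelihood β D₀ E θ) ∂μ₀
        ≤ ∫⁻ _, 1 ∂μ₀ := lintegral_mono fun θ => by
          simpa using M.likelihood_le_one β D₀ E θ
      _ = 1 := by simp
      _ < ⊤ := ENNReal.one_lt_top

/-- Sampling a parameter from the posterior, as a kernel in the data. -/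
def posteriorKernel [Nonempty A] (M : MDPFamily Θ S A H) (β : ℝ) (μ₀ : Measure Θ) (L t : ℕ) :
    Kernel ((Fin L → Episode S A H) × (Fin t → Episode S A H)) Θ :=
  Kernel.ofFunOfCountable fun D => M.posterior β μ₀ D.1 D.2

instance [Nonempty A] (M : MDPFamily Θ S A H) (β : ℝ) (μ₀ : Measure Θ) [IsProbabilityMeasure μ₀]
    (L t : ℕ) : IsMarkovKernel (M.posteriorKernel β μ₀ L t) :=
  ⟨fun D => inferInstanceAs (IsProbabilityMeasure (M.posterior β μ₀ D.1 D.2))⟩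

/-- One online episode: `(θ, θ')` is sent to the law of the episode in which `π*(θ')` is played in
the MDP with parameter `θ`. -/
def episodeKernel (M : MDPFamily Θ S A H) (π : M.OptimalSelection) :
    Kernel (Θ × Θ) (Episode S A H) :=
  finKernel (fun x e => M.episodeProb x.1 (π.policy x.2) e) fun e =>
    M.measurable_episodeProb measurable_fst (π.measurable_policy.comp measurable_snd) e

instance (M : MDPFamily Θ S A H) (π : M.OptimalSelection) : IsMarkovKernel (M.episodeKernel π) :=
  finKernel_isMarkovKernel _ _ (fun _ _ => M.episodeProb_nonneg _ _ _) fun _ =>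
    M.sum_episodeProb _ _

end MDPFamily

/-- Outcomes of `t` episodes of the interaction: the true parameter `θ*`, the offline dataset, and
for each online episode the sampled parameter together with the episode. -/
abbrev Run (Θ S A : Type*) (H L t : ℕ) :=
  Θ × (Fin L → Episode S A H) × (Fin t → Θ × Episode S A H)

namespace MDPFamily

variable {Θ S A : Type*} [MeasurableSpace Θ] [Fintype S] [Fintype A] [Nonempty A] {H : ℕ}

theorem measurable_runData (L t : ℕ) :
    Measurable fun x : Run Θ S A H L t => (x.2.1, fun j => (x.2.2 j).2) := by
  fun_prop

theorem measurable_runParam (L t : ℕ) :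
    Measurable fun y : Run Θ S A H L t × Θ => (y.1.1, y.2) := by
  fun_prop

/-- One round of the algorithm after `t` episodes: sample a parameter `θ'` from the posterior given
the offline data and the past online episodes, then play the policy `π*(θ')` for one episode in the
MDP with the true parameter. -/
def roundKernel (M : MDPFamily Θ S A H) (β : ℝ) (μ₀ : Measure Θ) (π : M.OptimalSelection)
    (L t : ℕ) : Kernel (Run Θ S A H L t) (Θ × Episode S A H) :=
  ((M.posteriorKernel β μ₀ L t).comap _ (measurable_runData L t)) ⊗ₖ
    ((M.episodeKernel π).comap _ (measurable_runParam L t))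

instance (M : MDPFamily Θ S A H) (β : ℝ) (μ₀ : Measure Θ) [IsProbabilityMeasure μ₀]
    (π : M.OptimalSelection) (L t : ℕ) : IsMarkovKernel (M.roundKernel β μ₀ π L t) := by
  unfold roundKernel; infer_instance

/-- The joint law of `θ* ∼ μ₀`, the offline dataset and the first `t` episodes of the informed
posterior sampling algorithm. -/
def runLaw (M : MDPFamily Θ S A H) (β : ℝ) (μ₀ : Measure Θ) (π : M.OptimalSelection) (L : ℕ) :
    (t : ℕ) → Measure (Run Θ S A H L t)
  | 0 => (μ₀ ⊗ₘ M.offlineKernel β L).map fun x => (x.1, x.2, Fin.elim0)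
  | t + 1 => (M.runLaw β μ₀ π L t ⊗ₘ M.roundKernel β μ₀ π L t).map fun x =>
      (x.1.1, x.1.2.1, Fin.snoc (α := fun _ => Θ × Episode S A H) x.1.2.2 x.2)

theorem measurable_extendRun (L t : ℕ) :
    Measurable fun x : Run Θ S A H L t × (Θ × Episode S A H) =>
      ((x.1.1, x.1.2.1, Fin.snoc (α := fun _ => Θ × Episode S A H) x.1.2.2 x.2) :
        Run Θ S A H L (t + 1)) := by
  refine Measurable.prodMk (by fun_prop) (Measurable.prodMk (by fun_prop) ?_)
  refine measurable_pi_iff.2 fun i => ?_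
  induction i using Fin.lastCases with
  | last => simp only [Fin.snoc_last]; fun_prop
  | cast i => simp only [Fin.snoc_castSucc]; fun_prop

instance (M : MDPFamily Θ S A H) (β : ℝ) (μ₀ : Measure Θ) [IsProbabilityMeasure μ₀]
    (π : M.OptimalSelection) (L t : ℕ) : IsProbabilityMeasure (M.runLaw β μ₀ π L t) := by
  induction t with
  | zero =>
    exact Measure.isProbabilityMeasure_map
      (measurable_fst.prodMk (measurable_snd.prodMk measurable_const)).aemeasurable
  | succ t ih => exact Measure.isProbabilityMeasure_map (measurable_extendRun L t).aemeasurable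

/-- The regret `∑_t (V*_0(s_0^t; θ*) - total reward of episode t)` along one run. -/
def runRegret (M : MDPFamily Θ S A H) {L T : ℕ} (ω : Run Θ S A H L T) : ℝ :=
  ∑ t : Fin T, (M.optV ω.1 0 ((ω.2.2 t).2.state 0) - M.totalReward (ω.2.2 t).2)

/-- The Bayesian regret of the algorithm over `T` episodes. -/
def bayesRegret (M : MDPFamily Θ S A H) (β : ℝ) (μ₀ : Measure Θ) (π : M.OptimalSelection)
    (L T : ℕ) : ℝ :=
  ∫ ω, M.runRegret ω ∂(M.runLaw β μ₀ π L T)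

/-- `ε`: the probability that the policy `π*(θ'_1)` used in the first episode differs from the
optimal policy `π*(θ*)` of the true MDP. -/
def misselectionProb (M : MDPFamily Θ S A H) (β : ℝ) (μ₀ : Measure Θ) (π : M.OptimalSelection)
    (L : ℕ) : ℝ :=
  (M.runLaw β μ₀ π L 1).real {ω | π.policy (ω.2.2 0).1 ≠ π.policy ω.1}

end MDPFamily

end IPSRL

end

/-! Conditionally on the offline data, the online episodes and all earlier samples, the true
parameter θ* and the next sample θ̃ are exchangeable (`map_swap_jointLaw`). Indeed the run has a
density with respect to a product of μ₀ and a measure not involving θ*, and this density is the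
likelihood (`exists_lintegral_runLaw_eq`): the learner's samples and action probabilities depend on
θ* only through the data.

Exchangeability is used three times. Write R(θ, p) for the expected return of policy p under θ, and
let Z be the event π*(θ̃) ≠ π*(θ*) in a given round. (1) Z is symmetric in θ* and θ̃, so 1_Z R(θ*,
π*(θ*)) has the same mean as 1_Z R(θ̃, π*(θ̃)). The regret of a round becomes the mean of 1_Z (R(θ̃,
π*(θ̃)) - R(θ*, π*(θ̃))), which compares one policy in two MDPs (`roundRegret_le`). (2) Pr(Z) ≤ 2ε
in every round (`jointLaw_ne_le`): the first sampled policy differs from π*(θ*) with probability ε,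
hence from π*(θ̃) with probability ε in any later round. (3) θ̃ is implausible given the data
exactly as often as θ* is.

By the simulation lemma (`expReturn_sub_expReturn`) the difference in (1) is at most H times the ℓ¹
transition errors, summed along an episode that is actually played. The inequality w ≤ (η + w²/η)/2
splits this into η·1_Z, which carries ε, and squared errors, which need no ε. A squared error is
O((S + log T)/n) at a pair visited n ≥ 1 times, unless θ* or θ̃ is implausible; an exponential
supermartingale and a union bound make that an event of probability at most 1/T
(`runLaw_implausible_le`). The inverse counts telescope to O(HSA(1 + log T)) (`potential_snoc`,
`sum_integral_sqDist_le`). Optimizing the one η common to all rounds plays the role of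
Cauchy–Schwarz and gives the bound. -/

noncomputable section

namespace IPSRL

namespace MDPFamily

/-! ### Expectations over episodes, Bellman telescoping and the simulation lemma. -/

section Path

variable {Θ S A : Type*} [MeasurableSpace Θ] [Fintype S] [Fintype A] {H : ℕ}

/-- One step of an episode is drawn from the policy and the transition probabilities given the
current state. -/
theorem sum_episodeProb_mul_step (M : MDPFamily Θ S A H) (θ : Θ) (π : Policy S A H) (h : Fin H)
    (f : S → A → S → ℝ) :
    ∑ e, M.episodeProb θ π e * f (e.state h.castSucc) (e.action h) (e.state h.succ) =
      ∑ e, M.episodeProb θ π e * ∑ a, (π h (e.state h.castSucc)).1 a *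
        ∑ s', (M.P θ h (e.state h.castSucc) a).1 s' * f (e.state h.castSucc) a s' := by
  classical
  set F : S → ℝ := fun s => ∑ a, (π h s).1 a * ∑ s', (M.P θ h s a).1 s' * f s a s' with hF
  have hw : ∀ (k : Fin H) s, ∑ a, ∑ s', (π k s).1 a * (M.P θ k s a).1 s' = 1 := fun k s => by
    simp only [← Finset.mul_sum, (M.P θ k s _).2.2, mul_one, (π k s).2.2]
  -- `F` is the conditional mean of `f` given the state, so multiplying the weights of step `h` by
  -- `1 + f - F` keeps their sum equal to one. The perturbed path weights therefore still have total
  -- mass one, and the difference from the unperturbed ones is the claim.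
  have key := sum_path (A := A) M.ν.1 H
    (fun k s a s' => (π k s).1 a * (M.P θ k s a).1 s' *
      if k = h then 1 + f s a s' - F s else 1) (fun k s => by
        by_cases hk : k = h
        · subst hk
          simp only [if_true, add_sub_assoc, mul_add, mul_sub, mul_one, Finset.sum_add_distrib,
            Finset.sum_sub_distrib, hw]
          have h1 : ∑ a, ∑ s', (π k s).1 a * (M.P θ k s a).1 s' * f s a s' = F s := by
            simp only [hF, Finset.mul_sum, mul_assoc]
          have h2 : ∑ a, ∑ s', (π k s).1 a * (M.P θ k s a).1 s' * F s = F s := by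
            simp only [← Finset.sum_mul, hw, one_mul]
          rw [h1, h2]; ring
        · simp only [hk, if_false, mul_one, hw])
  simp only [Finset.prod_mul_distrib, Finset.prod_ite_eq', Finset.mem_univ, if_true] at key
  have h3 : ∀ e : Episode S A H, M.episodeProb θ π e =
      M.ν.1 (e.state 0) * ((∏ k : Fin H, (π k (e.state k.castSucc)).1 (e.action k)) *
        ∏ k : Fin H, (M.P θ k (e.state k.castSucc) (e.action k)).1 (e.state k.succ)) := fun e => by
    simp only [episodeProb, Finset.prod_mul_distrib]
  have h4 : ∑ e, M.episodeProb θ π e *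
      (1 + f (e.state h.castSucc) (e.action h) (e.state h.succ) - F (e.state h.castSucc)) =
      ∑ e, M.episodeProb θ π e := by
    refine (Eq.trans ?_ (key.trans M.ν.2.2)).trans (M.sum_episodeProb θ π).symm
    exact Finset.sum_congr rfl fun e _ => by rw [h3 e]; ring
  simp only [mul_sub, mul_add, mul_one, Finset.sum_sub_distrib, Finset.sum_add_distrib] at h4
  linarith

theorem sum_episodeProb_mul_action (M : MDPFamily Θ S A H) (θ : Θ) (π : Policy S A H) (h : Fin H)
    (f : S → A → ℝ) :
    ∑ e, M.episodeProb θ π e * f (e.state h.castSucc) (e.action h) =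
      ∑ e, M.episodeProb θ π e * ∑ a, (π h (e.state h.castSucc)).1 a *
        f (e.state h.castSucc) a := by
  rw [M.sum_episodeProb_mul_step θ π h fun s a _ => f s a]
  simp only [← Finset.sum_mul, (M.P θ h _ _).2.2, one_mul]

theorem sum_episodeProb_mul_transition (M : MDPFamily Θ S A H) (θ : Θ) (π : Policy S A H)
    (h : Fin H) (f : S → A → S → ℝ) :
    ∑ e, M.episodeProb θ π e * f (e.state h.castSucc) (e.action h) (e.state h.succ) =
      ∑ e, M.episodeProb θ π e * ∑ s', (M.P θ h (e.state h.castSucc) (e.action h)).1 s' *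
        f (e.state h.castSucc) (e.action h) s' := by
  rw [M.sum_episodeProb_mul_step θ π h f, M.sum_episodeProb_mul_action θ π h
    fun s a => ∑ s', (M.P θ h s a).1 s' * f s a s']

theorem sum_episodeProb_mul_init (M : MDPFamily Θ S A H) (θ : Θ) (π : Policy S A H) (f : S → ℝ) :
    ∑ e, M.episodeProb θ π e * f (e.state 0) = ∑ s, M.ν.1 s * f s := by
  rw [← sum_path (A := A) (fun s => M.ν.1 s * f s) H
    (fun h s a s' => (π h s).1 a * (M.P θ h s a).1 s') (fun h s => by
      simp only [← Finset.mul_sum, (M.P θ h s _).2.2, mul_one, (π h s).2.2])]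
  exact Finset.sum_congr rfl fun e _ => by rw [episodeProb]; ring

/-- Reward plus expected value of the next state. -/
def backup (M : MDPFamily Θ S A H) (θ : Θ) (V : Fin (H + 1) → S → ℝ) (h : Fin H) (s : S) (a : A) :
    ℝ :=
  M.r h s a + ∑ s', (M.P θ h s a).1 s' * V h.succ s'

/-- The total reward telescopes along any value function with the right terminal value. -/
theorem expReturn_sub (M : MDPFamily Θ S A H) (θ : Θ) (π : Policy S A H)
    (V : Fin (H + 1) → S → ℝ) (hV : V (Fin.last H) = M.rEnd) :
    M.expReturn θ π - ∑ s, M.ν.1 s * V 0 s =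
      ∑ h : Fin H, ∑ e, M.episodeProb θ π e *
        (M.backup θ V h (e.state h.castSucc) (e.action h) - V h.castSucc (e.state h.castSucc)) := by
  have h1 : ∀ e : Episode S A H, M.totalReward e - V 0 (e.state 0) =
      ∑ h : Fin H, (M.r h (e.state h.castSucc) (e.action h) +
        (V h.succ (e.state h.succ) - V h.castSucc (e.state h.castSucc))) := fun e => by
    -- The same sum over `Fin (H + 1)`, split at its last and at its first term, gives the
    -- telescoping.
    have h2 := Fin.sum_univ_castSucc fun i => V i (e.state i)
    rw [Fin.sum_univ_succ] at h2
    rw [totalReward, Finset.sum_add_distrib, Finset.sum_sub_distrib, ← hV]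
    linarith
  rw [← M.sum_episodeProb_mul_init θ π (V 0), expReturn, ← Finset.sum_sub_distrib]
  simp only [← mul_sub, h1, Finset.mul_sum]
  rw [Finset.sum_comm]
  refine Finset.sum_congr rfl fun h _ => ?_
  have h3 := M.sum_episodeProb_mul_transition θ π h fun _ _ s' => V h.succ s'
  simp only [backup, mul_add, mul_sub, Finset.sum_add_distrib, Finset.sum_sub_distrib]
  rw [h3]; ring

/-- The value function of the policy `π`. -/
def polV (M : MDPFamily Θ S A H) (θ : Θ) (π : Policy S A H) : Fin (H + 1) → S → ℝ :=
  fun h => Fin.reverseInduction (motive := fun _ => S → ℝ) M.rEnd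
    (fun h V s => ∑ a, (π h s).1 a * (M.r h s a + ∑ s', (M.P θ h s a).1 s' * V s')) h

theorem polV_last (M : MDPFamily Θ S A H) (θ : Θ) (π : Policy S A H) :
    M.polV θ π (Fin.last H) = M.rEnd := by
  simp [polV]

theorem polV_castSucc (M : MDPFamily Θ S A H) (θ : Θ) (π : Policy S A H) (h : Fin H) (s : S) :
    M.polV θ π h.castSucc s = ∑ a, (π h s).1 a * M.backup θ (M.polV θ π) h s a := by
  simp only [polV, Fin.reverseInduction_castSucc]
  rfl

theorem polV_mem_Icc (M : MDPFamily Θ S A H) (θ : Θ) (π : Policy S A H) (h : Fin (H + 1)) :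
    ∀ s, M.polV θ π h s ∈ Set.Icc (0 : ℝ) (H + 1 - (h : ℕ)) := by
  induction h using Fin.reverseInduction with
  | last => intro s; rw [polV_last]; simpa using M.rEnd_mem s
  | cast h ih =>
    intro s
    rw [polV_castSucc]
    have h1 : ∀ a, M.backup θ (M.polV θ π) h s a ∈ Set.Icc (0 : ℝ) (H + 1 - (h : ℕ)) := fun a => by
      have hr := M.r_mem h s a
      have h2 : 0 ≤ ∑ s', (M.P θ h s a).1 s' * M.polV θ π h.succ s' :=
        Finset.sum_nonneg fun s' _ => mul_nonneg ((M.P θ h s a).2.1 s') (ih s').1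
      have h3 : ∑ s', (M.P θ h s a).1 s' * M.polV θ π h.succ s' ≤ H + 1 - ((h : ℕ) + 1) := by
        calc _ ≤ ∑ s', (M.P θ h s a).1 s' * ((H : ℝ) + 1 - ((h : ℕ) + 1)) :=
              Finset.sum_le_sum fun s' _ => mul_le_mul_of_nonneg_left
                (by simpa using (ih s').2) ((M.P θ h s a).2.1 s')
          _ = _ := by rw [← Finset.sum_mul, (M.P θ h s a).2.2, one_mul]
      exact ⟨add_nonneg hr.1 h2, by rw [backup]; linarith [hr.2]⟩
    refine ⟨Finset.sum_nonneg fun a _ => mul_nonneg ((π h s).2.1 a) (h1 a).1, ?_⟩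
    calc _ ≤ ∑ a, (π h s).1 a * ((H : ℝ) + 1 - (h : ℕ)) :=
          Finset.sum_le_sum fun a _ => mul_le_mul_of_nonneg_left (h1 a).2 ((π h s).2.1 a)
      _ = _ := by rw [← Finset.sum_mul, (π h s).2.2, one_mul]; simp

/-- Replacing the parameter in the return of a policy: the simulation lemma. -/
theorem expReturn_sub_expReturn (M : MDPFamily Θ S A H) (θ θ' : Θ) (π : Policy S A H) :
    M.expReturn θ π - M.expReturn θ' π =
      ∑ h : Fin H, ∑ e, M.episodeProb θ π e *
        ∑ s', ((M.P θ h (e.state h.castSucc) (e.action h)).1 s' -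
          (M.P θ' h (e.state h.castSucc) (e.action h)).1 s') * M.polV θ' π h.succ s' := by
  have key : ∀ θ₁, M.expReturn θ₁ π - ∑ s, M.ν.1 s * M.polV θ' π 0 s =
      ∑ h : Fin H, ∑ e, M.episodeProb θ₁ π e *
        ∑ s', ((M.P θ₁ h (e.state h.castSucc) (e.action h)).1 s' -
          (M.P θ' h (e.state h.castSucc) (e.action h)).1 s') * M.polV θ' π h.succ s' := fun θ₁ => by
    rw [M.expReturn_sub θ₁ π _ (M.polV_last θ' π)]
    refine Finset.sum_congr rfl fun h _ => ?_
    have h1 := M.sum_episodeProb_mul_action θ₁ π h fun s a => M.backup θ' (M.polV θ' π) h s a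
    simp only [polV_castSucc, mul_sub, Finset.sum_sub_distrib]
    rw [← h1]
    simp only [← Finset.sum_sub_distrib, ← mul_sub]
    refine Finset.sum_congr rfl fun e _ => ?_
    simp only [backup, sub_mul, Finset.sum_sub_distrib]
    ring
  -- At `θ₁ = θ'` the right side vanishes, which identifies the return under `θ'` with the mean
  -- initial value of `polV`.
  have h2 := key θ'
  simp only [sub_self, zero_mul, Finset.sum_const_zero, mul_zero] at h2
  rw [← key θ]; linarith

/-- The distance in total variation (`ℓ¹`) between transition probabilities. -/
def transDist (M : MDPFamily Θ S A H) (θ θ' : Θ) (h : Fin H) (s : S) (a : A) : ℝ :=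
  ∑ s', |(M.P θ h s a).1 s' - (M.P θ' h s a).1 s'|

theorem transDist_nonneg (M : MDPFamily Θ S A H) (θ θ' : Θ) (h : Fin H) (s : S) (a : A) :
    0 ≤ M.transDist θ θ' h s a :=
  Finset.sum_nonneg fun _ _ => abs_nonneg _

theorem transDist_le_two (M : MDPFamily Θ S A H) (θ θ' : Θ) (h : Fin H) (s : S) (a : A) :
    M.transDist θ θ' h s a ≤ 2 := by
  calc M.transDist θ θ' h s a ≤ ∑ s', ((M.P θ h s a).1 s' + (M.P θ' h s a).1 s') :=
        Finset.sum_le_sum fun s' _ => by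
          have h1 := (M.P θ h s a).2.1 s'
          have h2 := (M.P θ' h s a).2.1 s'
          rw [abs_le]; constructor <;> linarith
    _ = 2 := by
      rw [Finset.sum_add_distrib, (M.P θ h s a).2.2, (M.P θ' h s a).2.2]; norm_num

/-- In the simulation lemma only values at periods `h + 1` occur. They lie in `[0, H - h]`, so the
factor is `H` and not `H + 1`. -/
theorem abs_expReturn_sub_expReturn_le (M : MDPFamily Θ S A H) (θ θ' : Θ) (π : Policy S A H) :
    |M.expReturn θ π - M.expReturn θ' π| ≤
      H * ∑ e, M.episodeProb θ π e *
        ∑ h : Fin H, M.transDist θ θ' h (e.state h.castSucc) (e.action h) := by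
  rw [M.expReturn_sub_expReturn, Finset.sum_comm, Finset.mul_sum]
  refine (Finset.abs_sum_le_sum_abs _ _).trans (Finset.sum_le_sum fun e _ => ?_)
  rw [← Finset.mul_sum, abs_mul, abs_of_nonneg (M.episodeProb_nonneg θ π e), mul_left_comm]
  refine mul_le_mul_of_nonneg_left ?_ (M.episodeProb_nonneg θ π e)
  rw [Finset.mul_sum]
  refine (Finset.abs_sum_le_sum_abs _ _).trans (Finset.sum_le_sum fun h _ => ?_)
  rw [transDist, Finset.mul_sum]
  refine (Finset.abs_sum_le_sum_abs _ _).trans (Finset.sum_le_sum fun s' _ => ?_)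
  rw [abs_mul, mul_comm]
  refine mul_le_mul_of_nonneg_right ?_ (abs_nonneg _)
  have h1 := M.polV_mem_Icc θ' π h.succ s'
  rw [abs_of_nonneg h1.1]
  have h2 := h1.2
  simp only [Fin.val_succ, Nat.cast_add, Nat.cast_one] at h2
  have h3 : (0 : ℝ) ≤ (h : ℕ) := Nat.cast_nonneg _
  linarith

theorem totalReward_mem_Icc (M : MDPFamily Θ S A H) (e : Episode S A H) :
    M.totalReward e ∈ Set.Icc (0 : ℝ) (H + 1) := by
  refine ⟨add_nonneg (Finset.sum_nonneg fun h _ => (M.r_mem _ _ _).1) (M.rEnd_mem _).1,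
    add_le_add ?_ (M.rEnd_mem _).2⟩
  calc _ ≤ ∑ _h : Fin H, (1 : ℝ) := Finset.sum_le_sum fun h _ => (M.r_mem _ _ _).2
    _ = H := by simp

theorem expReturn_mem_Icc (M : MDPFamily Θ S A H) (θ : Θ) (π : Policy S A H) :
    M.expReturn θ π ∈ Set.Icc (0 : ℝ) (H + 1) := by
  refine ⟨Finset.sum_nonneg fun e _ => mul_nonneg (M.episodeProb_nonneg _ _ _)
    (M.totalReward_mem_Icc e).1, ?_⟩
  calc _ ≤ ∑ e, M.episodeProb θ π e * ((H : ℝ) + 1) := Finset.sum_le_sum fun e _ =>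
        mul_le_mul_of_nonneg_left (M.totalReward_mem_Icc e).2 (M.episodeProb_nonneg _ _ _)
    _ = _ := by rw [← Finset.sum_mul, M.sum_episodeProb, one_mul]

variable [Nonempty A]

theorem optV_mem_Icc (M : MDPFamily Θ S A H) (θ : Θ) (h : Fin (H + 1)) :
    ∀ s, M.optV θ h s ∈ Set.Icc (0 : ℝ) (H + 1 - (h : ℕ)) := by
  induction h using Fin.reverseInduction with
  | last => intro s; rw [optV_last]; simpa using M.rEnd_mem s
  | cast h ih =>
    intro s
    obtain ⟨a, -, ha⟩ := Finset.exists_mem_eq_sup' Finset.univ_nonempty (M.optQ θ h s)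
    rw [optV_castSucc, ha]
    have hr := M.r_mem h s a
    have h2 : 0 ≤ ∑ s', (M.P θ h s a).1 s' * M.optV θ h.succ s' :=
      Finset.sum_nonneg fun s' _ => mul_nonneg ((M.P θ h s a).2.1 s') (ih s').1
    have h3 : ∑ s', (M.P θ h s a).1 s' * M.optV θ h.succ s' ≤ H + 1 - ((h : ℕ) + 1) := by
      calc _ ≤ ∑ s', (M.P θ h s a).1 s' * ((H : ℝ) + 1 - ((h : ℕ) + 1)) :=
            Finset.sum_le_sum fun s' _ => mul_le_mul_of_nonneg_left
              (by simpa using (ih s').2) ((M.P θ h s a).2.1 s')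
        _ = _ := by rw [← Finset.sum_mul, (M.P θ h s a).2.2, one_mul]
    exact ⟨add_nonneg hr.1 h2, by rw [optQ, Fin.val_castSucc]; linarith [hr.2]⟩

/-- Every action's backup of `optV` is at most `optV`, so each telescoping term is nonpositive. -/
theorem expReturn_le_optV (M : MDPFamily Θ S A H) (θ : Θ) (π : Policy S A H) :
    M.expReturn θ π ≤ ∑ s, M.ν.1 s * M.optV θ 0 s := by
  rw [← sub_nonpos, M.expReturn_sub θ π (M.optV θ) (funext (M.optV_last θ))]
  refine Finset.sum_nonpos fun h _ => Finset.sum_nonpos fun e _ =>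
    mul_nonpos_of_nonneg_of_nonpos (M.episodeProb_nonneg θ π e) (sub_nonpos.2 ?_)
  rw [optV_castSucc]
  exact Finset.le_sup' (M.optQ θ h _) (Finset.mem_univ _)

/-- Optimal policies attain the optimal value. -/
theorem IsOptimal.expReturn_eq {M : MDPFamily Θ S A H} {θ : Θ} {π : Policy S A H}
    (hπ : M.IsOptimal θ π) : M.expReturn θ π = ∑ s, M.ν.1 s * M.optV θ 0 s := by
  classical
  refine le_antisymm (M.expReturn_le_optV θ π) ?_
  -- The greedy deterministic policy makes every telescoping term vanish.
  choose g hg using fun (h : Fin H) (s : S) =>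
    Finset.exists_mem_eq_sup' Finset.univ_nonempty (M.optQ θ h s)
  let π' : Policy S A H := fun h s => ⟨Pi.single (g h s) 1, single_mem_stdSimplex ℝ (g h s)⟩
  refine le_trans (le_of_eq ?_) (hπ π')
  rw [eq_comm, ← sub_eq_zero, M.expReturn_sub θ π' (M.optV θ) (funext (M.optV_last θ))]
  refine Finset.sum_eq_zero fun h _ => ?_
  have h1 := M.sum_episodeProb_mul_action θ π' h fun s a =>
    M.backup θ (M.optV θ) h s a - M.optV θ h.castSucc s
  rw [h1]
  refine Finset.sum_eq_zero fun e _ => ?_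
  simp only [π', Pi.single_apply, ite_mul, one_mul, zero_mul, Finset.sum_ite_eq', Finset.mem_univ,
    if_true]
  rw [optV_castSucc, (hg h _).2]
  simp [backup, optQ]

end Path

end MDPFamily

/-! ### Integration against finitely supported kernels. -/

section FinKernel

variable {X E : Type*} [MeasurableSpace X] [MeasurableSpace E] [Fintype E]
  [DiscreteMeasurableSpace E]

theorem lintegral_finKernel (w : X → E → ℝ) (hw : ∀ e, Measurable fun x => w x e) (x : X)
    (f : E → ENNReal) :
    ∫⁻ e, f e ∂(finKernel w hw x) = ∑ e, ENNReal.ofReal (w x e) * f e := by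
  change ∫⁻ e, f e ∂(∑ e, ENNReal.ofReal (w x e) • Measure.dirac e : Measure E) = _
  rw [lintegral_finsetSum_measure]
  exact Finset.sum_congr rfl fun e _ => by
    rw [lintegral_smul_measure, lintegral_dirac' _ (.of_discrete), smul_eq_mul]

theorem integral_finKernel (w : X → E → ℝ) (hw : ∀ e, Measurable fun x => w x e)
    (h0 : ∀ x e, 0 ≤ w x e) (x : X) (f : E → ℝ) :
    ∫ e, f e ∂(finKernel w hw x) = ∑ e, w x e * f e := by
  change ∫ e, f e ∂(∑ e, ENNReal.ofReal (w x e) • Measure.dirac e : Measure E) = _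
  rw [integral_finsetSum_measure fun e _ =>
    Integrable.smul_measure (integrable_dirac (by simp)) ENNReal.ofReal_ne_top]
  exact Finset.sum_congr rfl fun e _ => by
    rw [integral_smul_measure, integral_dirac, ENNReal.toReal_ofReal (h0 x e), smul_eq_mul]

theorem finKernel_isFiniteKernel (w : X → E → ℝ) (hw : ∀ e, Measurable fun x => w x e)
    (h1 : ∀ x e, w x e ≤ 1) : IsFiniteKernel (finKernel w hw) := by
  refine ⟨Fintype.card E, ENNReal.natCast_lt_top _, fun x => ?_⟩
  rw [← lintegral_one, lintegral_finKernel]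
  calc _ ≤ ∑ _e : E, (1 : ENNReal) := Finset.sum_le_sum fun e _ => by
        simpa using h1 x e
    _ = _ := by simp

end FinKernel

namespace MDPFamily

/-! ### The law of a run and the exchangeability of true and sampled parameter. -/

section Law

variable {Θ S A : Type*} [MeasurableSpace Θ] [Fintype S] [Fintype A] [Nonempty A] {H : ℕ}

/-- A run of `t` episodes together with the parameter sampled for the next one. -/
def jointLaw (M : MDPFamily Θ S A H) (β : ℝ) (μ₀ : Measure Θ) (π : M.OptimalSelection)
    (L t : ℕ) : Measure (Run Θ S A H L t × Θ) :=
  M.runLaw β μ₀ π L t ⊗ₘ (M.posteriorKernel β μ₀ L t).comap _ (measurable_runData L t)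

instance (M : MDPFamily Θ S A H) (β : ℝ) (μ₀ : Measure Θ) [IsProbabilityMeasure μ₀]
    (π : M.OptimalSelection) (L t : ℕ) : IsProbabilityMeasure (M.jointLaw β μ₀ π L t) := by
  unfold jointLaw; infer_instance

/-- Append the next episode to a run. -/
def extendRun {L t : ℕ} (y : Run Θ S A H L t × Θ) (e : Episode S A H) : Run Θ S A H L (t + 1) :=
  (y.1.1, y.1.2.1, Fin.snoc (α := fun _ => Θ × Episode S A H) y.1.2.2 (y.2, e))

theorem measurable_extendRun_uncurry (L t : ℕ) :
    Measurable fun z : (Run Θ S A H L t × Θ) × Episode S A H => extendRun z.1 z.2 :=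
  (measurable_extendRun L t).comp (g := fun x : Run Θ S A H L t × (Θ × Episode S A H) =>
      ((x.1.1, x.1.2.1, Fin.snoc (α := fun _ => Θ × Episode S A H) x.1.2.2 x.2) :
        Run Θ S A H L (t + 1)))
    (f := fun z : (Run Θ S A H L t × Θ) × Episode S A H => (z.1.1, (z.1.2, z.2))) (by fun_prop)

/-- A round is regrouped as (run, sample) followed by an episode, because exchangeability holds
before the new episode is seen. -/
theorem runLaw_succ (M : MDPFamily Θ S A H) (β : ℝ) (μ₀ : Measure Θ) [IsProbabilityMeasure μ₀]
    (π : M.OptimalSelection) (L t : ℕ) :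
    M.runLaw β μ₀ π L (t + 1) =
      (M.jointLaw β μ₀ π L t ⊗ₘ (M.episodeKernel π).comap _ (measurable_runParam L t)).map
        fun z => extendRun z.1 z.2 := by
  refine Measure.ext_of_lintegral _ fun f hf => ?_
  have hf1 := hf.fun_comp (measurable_extendRun (Θ := Θ) (S := S) (A := A) (H := H) L t)
  have hf2 := hf.fun_comp (measurable_extendRun_uncurry (Θ := Θ) (S := S) (A := A) (H := H) L t)
  rw [runLaw, lintegral_map hf (measurable_extendRun L t),
    lintegral_map hf (measurable_extendRun_uncurry L t), Measure.lintegral_compProd hf1,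
    Measure.lintegral_compProd hf2, jointLaw, Measure.lintegral_compProd]
  · refine lintegral_congr fun ω => ?_
    rw [roundKernel, Kernel.lintegral_compProd]
    · rfl
    · exact hf1.fun_comp measurable_prodMk_left
  · exact hf2.lintegral_kernel_prod_right'

theorem lintegral_runLaw_succ (M : MDPFamily Θ S A H) (β : ℝ) (μ₀ : Measure Θ)
    [IsProbabilityMeasure μ₀] (π : M.OptimalSelection) (L t : ℕ)
    {f : Run Θ S A H L (t + 1) → ENNReal} (hf : Measurable f) :
    ∫⁻ ω, f ω ∂(M.runLaw β μ₀ π L (t + 1)) = ∫⁻ y, ∑ e,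
      ENNReal.ofReal (M.episodeProb y.1.1 (π.policy y.2) e) * f (extendRun y e)
        ∂(M.jointLaw β μ₀ π L t) := by
  have hf2 := hf.fun_comp (measurable_extendRun_uncurry (Θ := Θ) (S := S) (A := A) (H := H) L t)
  rw [runLaw_succ, lintegral_map hf (measurable_extendRun_uncurry L t),
    Measure.lintegral_compProd hf2]
  refine lintegral_congr fun y => ?_
  rw [Kernel.comap_apply, episodeKernel, lintegral_finKernel]

theorem integrable_of_abs_le {X : Type*} [MeasurableSpace X] {μ : Measure X} [IsFiniteMeasure μ]
    {f : X → ℝ} (hf : Measurable f) {B : ℝ} (hB : ∀ x, |f x| ≤ B) : Integrable f μ :=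
  Integrable.of_bound hf.aestronglyMeasurable B (.of_forall hB)

theorem integral_runLaw_succ (M : MDPFamily Θ S A H) (β : ℝ) (μ₀ : Measure Θ)
    [IsProbabilityMeasure μ₀] (π : M.OptimalSelection) (L t : ℕ)
    {f : Run Θ S A H L (t + 1) → ℝ} (hf : Measurable f) {B : ℝ} (hB : ∀ ω, |f ω| ≤ B) :
    ∫ ω, f ω ∂(M.runLaw β μ₀ π L (t + 1)) = ∫ y, ∑ e,
      M.episodeProb y.1.1 (π.policy y.2) e * f (extendRun y e) ∂(M.jointLaw β μ₀ π L t) := by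
  have hf2 := hf.fun_comp (measurable_extendRun_uncurry (Θ := Θ) (S := S) (A := A) (H := H) L t)
  rw [runLaw_succ, integral_map (measurable_extendRun_uncurry L t).aemeasurable
    hf.aestronglyMeasurable, Measure.integral_compProd (integrable_of_abs_le hf2 fun z => hB _)]
  refine integral_congr_ae (.of_forall fun y => ?_)
  simp only [Kernel.comap_apply, episodeKernel]
  rw [integral_finKernel _ _ fun _ _ => M.episodeProb_nonneg _ _ _]

theorem measurable_likelihood (M : MDPFamily Θ S A H) (β : ℝ) {L t : ℕ}
    (D₀ : Fin L → Episode S A H) (E : Fin t → Episode S A H) :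
    Measurable (M.likelihood β D₀ E) :=
  (M.measurable_offlineProb β D₀).mul (Finset.measurable_prod _ fun _ _ =>
    Finset.measurable_prod _ fun _ _ => M.measurable_P_apply _ _ _ _)

theorem measurable_likelihood_run (M : MDPFamily Θ S A H) (β : ℝ) (L t : ℕ) :
    Measurable fun ω : Run Θ S A H L t => M.likelihood β ω.2.1 (fun j => (ω.2.2 j).2) ω.1 := by
  have h : Measurable fun z : Θ × ((Fin L → Episode S A H) × (Fin t → Episode S A H)) =>
      M.likelihood β z.2.1 z.2.2 z.1 :=
    measurable_from_prod_countable_left fun D => M.measurable_likelihood β D.1 D.2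
  exact h.fun_comp (measurable_fst.prodMk (measurable_runData L t))

theorem likelihood_nonneg (M : MDPFamily Θ S A H) (β : ℝ) {L t : ℕ}
    (D₀ : Fin L → Episode S A H) (E : Fin t → Episode S A H) (θ : Θ) :
    0 ≤ M.likelihood β D₀ E θ :=
  mul_nonneg (Finset.prod_nonneg fun _ _ => M.episodeProb_nonneg _ _ _)
    (Finset.prod_nonneg fun _ _ => Finset.prod_nonneg fun _ _ => (M.P _ _ _ _).2.1 _)

/-- Two parameters, one weighted by the likelihood and one drawn from the posterior, are
exchangeable. -/
theorem lintegral_likelihood_mul_posterior_comm (M : MDPFamily Θ S A H) (β : ℝ) (μ₀ : Measure Θ)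
    [IsProbabilityMeasure μ₀] {L t : ℕ} (D₀ : Fin L → Episode S A H) (E : Fin t → Episode S A H)
    {g : Θ → Θ → ENNReal} (hg : Measurable (Function.uncurry g)) :
    ∫⁻ θ, ENNReal.ofReal (M.likelihood β D₀ E θ) * ∫⁻ θ', g θ θ' ∂(M.posterior β μ₀ D₀ E) ∂μ₀ =
      ∫⁻ θ, ENNReal.ofReal (M.likelihood β D₀ E θ) *
        ∫⁻ θ', g θ' θ ∂(M.posterior β μ₀ D₀ E) ∂μ₀ := by
  have hm : Measurable fun θ => ENNReal.ofReal (M.likelihood β D₀ E θ) :=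
    (M.measurable_likelihood β D₀ E).ennreal_ofReal
  -- Under zero marginal likelihood both sides vanish, so the default value of the posterior is
  -- irrelevant.
  by_cases h : ∫⁻ θ, ENNReal.ofReal (M.likelihood β D₀ E θ) ∂μ₀ = 0
  · have h0 := (lintegral_eq_zero_iff hm).1 h
    have h1 : ∀ f : Θ → ENNReal, ∫⁻ θ, ENNReal.ofReal (M.likelihood β D₀ E θ) * f θ ∂μ₀ = 0 :=
      fun f => by
        rw [lintegral_congr_ae (g := fun _ => 0), lintegral_zero]
        filter_upwards [h0] with θ hθ
        simp only [Pi.zero_apply] at hθ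
        rw [hθ, zero_mul]
    rw [h1, h1]
  · set c := (∫⁻ θ, ENNReal.ofReal (M.likelihood β D₀ E θ) ∂μ₀)⁻¹ with hc
    have h1 : ∀ f : Θ → ENNReal, Measurable f → ∫⁻ θ', f θ' ∂(M.posterior β μ₀ D₀ E) =
        ∫⁻ θ', c * (ENNReal.ofReal (M.likelihood β D₀ E θ') * f θ') ∂μ₀ := fun f hf => by
      rw [posterior, if_neg h, lintegral_smul_measure,
        lintegral_withDensity_eq_lintegral_mul _ hm hf, smul_eq_mul,
        ← lintegral_const_mul _ (hm.mul hf)]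
      rfl
    have hl : ∀ θ, Measurable fun θ' => g θ θ' := fun θ => hg.fun_comp measurable_prodMk_left
    have hr : ∀ θ, Measurable fun θ' => g θ' θ := fun θ => hg.fun_comp measurable_prodMk_right
    have e1 : ∀ θ, ENNReal.ofReal (M.likelihood β D₀ E θ) *
        ∫⁻ θ', g θ θ' ∂(M.posterior β μ₀ D₀ E) = ∫⁻ θ', ENNReal.ofReal (M.likelihood β D₀ E θ) *
          (c * (ENNReal.ofReal (M.likelihood β D₀ E θ') * g θ θ')) ∂μ₀ := fun θ => by
      rw [h1 _ (hl θ), lintegral_const_mul _ ((hm.fun_mul (hl θ)).const_mul c)]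
    have e2 : ∀ θ, ENNReal.ofReal (M.likelihood β D₀ E θ) *
        ∫⁻ θ', g θ' θ ∂(M.posterior β μ₀ D₀ E) = ∫⁻ θ', ENNReal.ofReal (M.likelihood β D₀ E θ) *
          (c * (ENNReal.ofReal (M.likelihood β D₀ E θ') * g θ' θ)) ∂μ₀ := fun θ => by
      rw [h1 _ (hr θ), lintegral_const_mul _ ((hm.fun_mul (hr θ)).const_mul c)]
    -- With the posterior written out, the weight of `(θ, θ')` is a constant times the product of
    -- the two likelihoods. This is symmetric, and Tonelli exchanges the variables.
    rw [lintegral_congr e1, lintegral_congr e2, lintegral_lintegral_swap]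
    · refine lintegral_congr fun θ => lintegral_congr fun θ' => ?_
      ring
    · exact ((hm.fun_comp measurable_fst).mul
        (((hm.fun_comp measurable_snd).mul hg).const_mul c)).aemeasurable

/-- The probability of the initial state and of the actions of an episode, given the states. -/
def actionProb (M : MDPFamily Θ S A H) (π : Policy S A H) (e : Episode S A H) : ℝ :=
  M.ν.1 (e.state 0) * ∏ h : Fin H, (π h (e.state h.castSucc)).1 (e.action h)

theorem actionProb_nonneg (M : MDPFamily Θ S A H) (π : Policy S A H) (e : Episode S A H) :
    0 ≤ M.actionProb π e :=
  mul_nonneg (M.ν.2.1 _) (Finset.prod_nonneg fun _ _ => (π _ _).2.1 _)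

theorem stdSimplex_apply_le_one {E : Type*} [Fintype E] (p : stdSimplex ℝ E) (x : E) :
    p.1 x ≤ 1 :=
  (Finset.single_le_sum (fun x _ => p.2.1 x) (Finset.mem_univ x)).trans p.2.2.le

theorem actionProb_le_one (M : MDPFamily Θ S A H) (π : Policy S A H) (e : Episode S A H) :
    M.actionProb π e ≤ 1 :=
  mul_le_one₀ (stdSimplex_apply_le_one _ _) (Finset.prod_nonneg fun _ _ => (π _ _).2.1 _)
    (Finset.prod_le_one (fun _ _ => (π _ _).2.1 _) fun _ _ => stdSimplex_apply_le_one _ _)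

theorem measurable_actionProb (M : MDPFamily Θ S A H) (e : Episode S A H) :
    Measurable fun π => M.actionProb π e := by
  refine measurable_const.mul (Finset.measurable_prod _ fun h _ => ?_)
  have h1 : Measurable fun π : Policy S A H => π h (e.state h.castSucc) := by fun_prop
  exact measurable_pi_iff.1 (measurable_subtype_coe.fun_comp h1) _

/-- Bayesian updating: the transition factors of a new episode join the likelihood, and the
remaining factor is free of `θ`. -/
theorem likelihood_mul_episodeProb (M : MDPFamily Θ S A H) (β : ℝ) {L t : ℕ}
    (D₀ : Fin L → Episode S A H) (E : Fin t → Episode S A H) (e : Episode S A H) (θ : Θ)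
    (π : Policy S A H) :
    M.likelihood β D₀ E θ * M.episodeProb θ π e = M.actionProb π e *
      M.likelihood β D₀ (Fin.snoc (α := fun _ => Episode S A H) E e) θ := by
  simp only [likelihood, episodeProb, actionProb, Fin.prod_univ_castSucc (n := t),
    Fin.snoc_castSucc, Fin.snoc_last, Finset.prod_mul_distrib]
  ring

/-- The joint law of the true parameter and everything that is observed or sampled has the
likelihood as its density with respect to a product measure. -/
theorem exists_lintegral_runLaw_eq (M : MDPFamily Θ S A H) (β : ℝ) (μ₀ : Measure Θ)
    [IsProbabilityMeasure μ₀] (π : M.OptimalSelection) (L t : ℕ) :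
    ∃ ρ : Measure ((Fin L → Episode S A H) × (Fin t → Θ × Episode S A H)), SFinite ρ ∧
      ∀ f : Run Θ S A H L t → ENNReal, Measurable f →
        ∫⁻ ω, f ω ∂(M.runLaw β μ₀ π L t) = ∫⁻ x, ∫⁻ θ,
          ENNReal.ofReal (M.likelihood β x.1 (fun j => (x.2 j).2) θ) * f (θ, x) ∂μ₀ ∂ρ := by
  induction t with
  | zero =>
    have hm : Measurable fun D : Fin L → Episode S A H =>
        (D, (Fin.elim0 : Fin 0 → Θ × Episode S A H)) := by fun_prop
    -- Without online episodes the likelihood is the probability mass of the offline dataset, hence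
    -- its density with respect to counting measure.
    refine ⟨Measure.count.map fun D => (D, Fin.elim0), inferInstance, fun f hf => ?_⟩
    have hg : Measurable fun x : Θ × (Fin L → Episode S A H) =>
        ((x.1, x.2, Fin.elim0) : Run Θ S A H L 0) := by fun_prop
    rw [runLaw, lintegral_map hf hg, Measure.lintegral_compProd (hf.fun_comp hg), lintegral_map
        (((M.measurable_likelihood_run β L 0).ennreal_ofReal.fun_mul hf).lintegral_prod_left') hm]
    rw [lintegral_count, tsum_fintype]
    simp only [offlineKernel, lintegral_finKernel, likelihood, Finset.univ_eq_empty,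
      Finset.prod_empty, mul_one]
    rw [lintegral_finsetSum]
    intro D _
    exact (M.measurable_offlineProb β D).ennreal_ofReal.mul (hf.fun_comp (by fun_prop))
  | succ t ih =>
    obtain ⟨ρ, hρ, hfac⟩ := ih
    have hd : Measurable fun x : (Fin L → Episode S A H) × (Fin t → Θ × Episode S A H) =>
      (x.1, fun j => (x.2 j).2) := by fun_prop
    let w : ((Fin L → Episode S A H) × (Fin t → Θ × Episode S A H)) × Θ → Episode S A H → ℝ :=
      fun z e => M.actionProb (π.policy z.2) e
    have hw : ∀ e, Measurable fun z => w z e := fun e =>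
      (M.measurable_actionProb e).fun_comp (π.measurable_policy.fun_comp measurable_snd)
    -- With the transition probabilities removed, the weights of the episodes need not sum to one,
    -- so this kernel is finite but not Markov in general.
    have : IsFiniteKernel (finKernel w hw) :=
      finKernel_isFiniteKernel w hw fun _ _ => M.actionProb_le_one _ _
    -- The part of a round that does not see the true parameter: sample from the posterior of the
    -- data, then weight episodes by initial state and actions only.
    let κ := ((M.posteriorKernel β μ₀ L t).comap _ hd) ⊗ₖ finKernel w hw
    have hs : Measurable fun z : ((Fin L → Episode S A H) × (Fin t → Θ × Episode S A H)) ×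
        (Θ × Episode S A H) => (z.1.1, Fin.snoc (α := fun _ => Θ × Episode S A H) z.1.2 z.2) := by
      refine Measurable.prodMk (by fun_prop) (measurable_pi_iff.2 fun i => ?_)
      induction i using Fin.lastCases with
      | last => simp only [Fin.snoc_last]; fun_prop
      | cast i => simp only [Fin.snoc_castSucc]; fun_prop
    refine ⟨(ρ ⊗ₘ κ).map fun z =>
      (z.1.1, Fin.snoc (α := fun _ => Θ × Episode S A H) z.1.2 z.2), inferInstance,
      fun f hf => ?_⟩
    have hf2 := hf.fun_comp (measurable_extendRun_uncurry (Θ := Θ) (S := S) (A := A) (H := H) L t)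
    have hprob : ∀ e, Measurable fun y : Run Θ S A H L t × Θ =>
        ENNReal.ofReal (M.episodeProb y.1.1 (π.policy y.2) e) * f (extendRun y e) := fun e =>
      (M.measurable_episodeProb (f := fun y : Run Θ S A H L t × Θ => y.1.1) (by fun_prop)
        (π.measurable_policy.fun_comp measurable_snd) e).ennreal_ofReal.mul
        (hf2.fun_comp measurable_prodMk_right)
    have hsum : Measurable fun y : Run Θ S A H L t × Θ => ∑ e,
        ENNReal.ofReal (M.episodeProb y.1.1 (π.policy y.2) e) * f (extendRun y e) :=
      Finset.measurable_fun_sum Finset.univ fun e _ => hprob e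
    have hlik : Measurable fun x : Run Θ S A H L (t + 1) =>
        ENNReal.ofReal (M.likelihood β x.2.1 (fun j => (x.2.2 j).2) x.1) * f x :=
      (M.measurable_likelihood_run β L (t + 1)).ennreal_ofReal.mul hf
    have hint := hlik.lintegral_prod_left' (μ := μ₀)
    rw [M.lintegral_runLaw_succ β μ₀ π L t hf, jointLaw, Measure.lintegral_compProd hsum,
      hfac _ (Measurable.lintegral_kernel_prod_right' hsum), lintegral_map hint hs,
      Measure.lintegral_compProd (hint.fun_comp hs)]
    refine lintegral_congr fun x => ?_
    rw [Kernel.lintegral_compProd _ _ _ ((hint.fun_comp hs).fun_comp measurable_prodMk_left)]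
    simp only [Kernel.comap_apply, lintegral_finKernel, w]
    have hx : Measurable fun p : Θ × Θ => (((p.1, x), p.2) : Run Θ S A H L t × Θ) := by fun_prop
    have hin : Measurable fun p : Θ × Θ => ∑ e,
        ENNReal.ofReal (M.episodeProb p.1 (π.policy p.2) e) * f (extendRun ((p.1, x), p.2) e) :=
      (hsum.comp hx :)
    have hl : Measurable fun θ =>
        ENNReal.ofReal (M.likelihood β x.1 (fun j => (x.2 j).2) θ) :=
      (M.measurable_likelihood β _ _).ennreal_ofReal
    simp_rw [← lintegral_const_mul _ (hin.fun_comp measurable_prodMk_left)]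
    rw [lintegral_lintegral_swap]
    · refine lintegral_congr fun θ' => ?_
      simp only [Finset.mul_sum]
      rw [lintegral_finsetSum]
      · refine Finset.sum_congr rfl fun e _ => ?_
        have hxe : Measurable fun θ : Θ => ((θ, x.1, Fin.snoc (α := fun _ => Θ × Episode S A H)
          x.2 (θ', e)) : Run Θ S A H L (t + 1)) := by fun_prop
        rw [← lintegral_const_mul _ (hlik.fun_comp hxe)]
        refine lintegral_congr fun θ => ?_
        simp only [extendRun]
        rw [← mul_assoc, ← mul_assoc, ← ENNReal.ofReal_mul (M.likelihood_nonneg _ _ _ _),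
          ← ENNReal.ofReal_mul (M.actionProb_nonneg _ _), M.likelihood_mul_episodeProb]
        congr 4
        funext j
        induction j using Fin.lastCases with
        | last => simp only [Fin.snoc_last]
        | cast i => simp only [Fin.snoc_castSucc]
      · intro e _
        have hxθ : Measurable fun θ => (((θ, x), θ') : Run Θ S A H L t × Θ) := by fun_prop
        exact hl.fun_mul ((hprob e).comp hxθ :)
    · exact ((hl.fun_comp measurable_fst).mul hin).aemeasurable

/-- Given all observations and all sampled parameters, the true parameter and the next sampled
parameter are exchangeable. -/
theorem map_swap_jointLaw (M : MDPFamily Θ S A H) (β : ℝ) (μ₀ : Measure Θ)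
    [IsProbabilityMeasure μ₀] (π : M.OptimalSelection) (L t : ℕ) :
    (M.jointLaw β μ₀ π L t).map (fun y => ((y.2, y.1.2), y.1.1)) = M.jointLaw β μ₀ π L t := by
  obtain ⟨ρ, hρ, hfac⟩ := M.exists_lintegral_runLaw_eq β μ₀ π L t
  refine Measure.ext_of_lintegral _ fun f hf => ?_
  have hs : Measurable fun y : Run Θ S A H L t × Θ =>
      (((y.2, y.1.2), y.1.1) : Run Θ S A H L t × Θ) := by fun_prop
  rw [lintegral_map hf hs, jointLaw, Measure.lintegral_compProd (hf.fun_comp hs),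
    Measure.lintegral_compProd hf,
    hfac _ (Measurable.lintegral_kernel_prod_right' (hf.fun_comp hs)),
    hfac _ (Measurable.lintegral_kernel_prod_right' hf)]
  refine lintegral_congr fun x => ?_
  have hx : Measurable fun p : Θ × Θ => (((p.1, x), p.2) : Run Θ S A H L t × Θ) := by fun_prop
  exact (M.lintegral_likelihood_mul_posterior_comm β μ₀ x.1 (fun j => (x.2 j).2)
    (g := fun θ θ' => f ((θ, x), θ')) (hf.fun_comp hx)).symm

end Law

/-! ### Probability of playing a policy other than the selected optimal one. -/

section Misselection

variable {Θ S A : Type*} [MeasurableSpace Θ] [Fintype S] [Fintype A] [Nonempty A] {H : ℕ}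

theorem lintegral_runLaw_succ_of_extendRun (M : MDPFamily Θ S A H) (β : ℝ) (μ₀ : Measure Θ)
    [IsProbabilityMeasure μ₀] (π : M.OptimalSelection) (L t : ℕ)
    {f : Run Θ S A H L (t + 1) → ENNReal} (hf : Measurable f)
    {g : Run Θ S A H L t × Θ → ENNReal} (hfg : ∀ y e, f (extendRun y e) = g y) :
    ∫⁻ ω, f ω ∂(M.runLaw β μ₀ π L (t + 1)) = ∫⁻ y, g y ∂(M.jointLaw β μ₀ π L t) := by
  rw [M.lintegral_runLaw_succ β μ₀ π L t hf]
  refine lintegral_congr fun y => ?_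
  simp only [hfg, ← Finset.sum_mul]
  rw [← ENNReal.ofReal_sum_of_nonneg fun e _ => M.episodeProb_nonneg _ _ _, M.sum_episodeProb,
    ENNReal.ofReal_one, one_mul]

theorem lintegral_jointLaw_fst (M : MDPFamily Θ S A H) (β : ℝ) (μ₀ : Measure Θ)
    [IsProbabilityMeasure μ₀] (π : M.OptimalSelection) (L t : ℕ)
    {f : Run Θ S A H L t → ENNReal} (hf : Measurable f) :
    ∫⁻ y, f y.1 ∂(M.jointLaw β μ₀ π L t) = ∫⁻ ω, f ω ∂(M.runLaw β μ₀ π L t) := by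
  rw [jointLaw, Measure.lintegral_compProd (hf.fun_comp measurable_fst)]
  simp

theorem measurableSet_policy_ne (M : MDPFamily Θ S A H) (π : M.OptimalSelection) {X : Type*}
    [MeasurableSpace X] {f g : X → Θ} (hf : Measurable f) (hg : Measurable g) :
    MeasurableSet {x | π.policy (f x) ≠ π.policy (g x)} :=
  (measurableSet_eq_fun (π.measurable_policy.comp hf) (π.measurable_policy.comp hg)).compl

/-- The event involves only the true parameter and the first sample, which later rounds leave
untouched. -/
theorem runLaw_first_ne (M : MDPFamily Θ S A H) (β : ℝ) (μ₀ : Measure Θ)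
    [IsProbabilityMeasure μ₀] (π : M.OptimalSelection) (L t : ℕ) :
    M.runLaw β μ₀ π L (t + 1) {ω | π.policy (ω.2.2 0).1 ≠ π.policy ω.1} =
      M.runLaw β μ₀ π L 1 {ω | π.policy (ω.2.2 0).1 ≠ π.policy ω.1} := by
  classical
  have hms : ∀ t, MeasurableSet
      {ω : Run Θ S A H L (t + 1) | π.policy (ω.2.2 0).1 ≠ π.policy ω.1} := fun t =>
    M.measurableSet_policy_ne π (by fun_prop) (by fun_prop)
  induction t with
  | zero => rfl
  | succ t ih =>
    rw [← ih, ← lintegral_indicator_one (hms _), ← lintegral_indicator_one (hms _),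
      ← M.lintegral_jointLaw_fst β μ₀ π L _ (measurable_one.indicator (hms t))]
    refine M.lintegral_runLaw_succ_of_extendRun β μ₀ π L _ (measurable_one.indicator (hms _))
      fun y e => ?_
    have h0 : (Fin.snoc (α := fun _ => Θ × Episode S A H) y.1.2.2 (y.2, e)) 0 = y.1.2.2 0 :=
      Fin.snoc_castSucc (α := fun _ => Θ × Episode S A H) (y.2, e) y.1.2.2 0
    simp only [Set.indicator_apply, Set.mem_ofPred_eq, extendRun, h0, Pi.one_apply]

/-- The first sample serves as a pivot. Its policy differs from that of the true parameter with
probability ε; swapping the true parameter with the current sample keeps the first sample fixed, so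
the same holds for the current sample. The triangle inequality gives 2ε. Before the first episode
the probability is ε itself. -/
theorem jointLaw_ne_le (M : MDPFamily Θ S A H) (β : ℝ) (μ₀ : Measure Θ)
    [IsProbabilityMeasure μ₀] (π : M.OptimalSelection) (L t : ℕ) :
    (M.jointLaw β μ₀ π L t).real {y | π.policy y.2 ≠ π.policy y.1.1} ≤
      2 * M.misselectionProb β μ₀ π L := by
  classical
  have h0 : 0 ≤ M.misselectionProb β μ₀ π L := measureReal_nonneg
  cases t with
  | zero =>
    have hm : MeasurableSet {ω : Run Θ S A H L 1 | π.policy (ω.2.2 0).1 ≠ π.policy ω.1} :=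
      M.measurableSet_policy_ne π (by fun_prop) (by fun_prop)
    have hm2 : MeasurableSet {y : Run Θ S A H L 0 × Θ | π.policy y.2 ≠ π.policy y.1.1} :=
      M.measurableSet_policy_ne π (by fun_prop) (by fun_prop)
    have h1 : (M.jointLaw β μ₀ π L 0).real {y | π.policy y.2 ≠ π.policy y.1.1} =
        M.misselectionProb β μ₀ π L := by
      rw [misselectionProb, measureReal_def, measureReal_def, ← lintegral_indicator_one hm,
        ← lintegral_indicator_one hm2]
      refine congrArg _ (M.lintegral_runLaw_succ_of_extendRun β μ₀ π L _
        (measurable_one.indicator hm) fun y e => ?_).symm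
      -- In a run of length one, index `0` is also the last index.
      have h2 : (Fin.snoc (α := fun _ => Θ × Episode S A H) y.1.2.2 (y.2, e)) 0 = (y.2, e) :=
        Fin.snoc_last (α := fun _ => Θ × Episode S A H) (y.2, e) y.1.2.2
      simp only [Set.indicator_apply, Set.mem_ofPred_eq, extendRun, h2, Pi.one_apply]
    linarith
  | succ t =>
    have hm : MeasurableSet {ω : Run Θ S A H L (t + 1) | π.policy (ω.2.2 0).1 ≠ π.policy ω.1} :=
      M.measurableSet_policy_ne π (by fun_prop) (by fun_prop)
    have hm' : MeasurableSet
        {y : Run Θ S A H L (t + 1) × Θ | π.policy (y.1.2.2 0).1 ≠ π.policy y.1.1} :=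
      M.measurableSet_policy_ne π (by fun_prop) (by fun_prop)
    have h1 : M.jointLaw β μ₀ π L (t + 1) {y | π.policy (y.1.2.2 0).1 ≠ π.policy y.1.1} =
        M.runLaw β μ₀ π L 1 {ω | π.policy (ω.2.2 0).1 ≠ π.policy ω.1} := by
      rw [← M.runLaw_first_ne β μ₀ π L t, ← lintegral_indicator_one hm,
        ← M.lintegral_jointLaw_fst β μ₀ π L _ (measurable_one.indicator hm),
        ← lintegral_indicator_one hm']
      rfl
    have hsw : Measurable fun y : Run Θ S A H L (t + 1) × Θ =>
        (((y.2, y.1.2), y.1.1) : Run Θ S A H L (t + 1) × Θ) := by fun_prop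
    have h2 : M.jointLaw β μ₀ π L (t + 1) {y | π.policy (y.1.2.2 0).1 ≠ π.policy y.2} =
        M.runLaw β μ₀ π L 1 {ω | π.policy (ω.2.2 0).1 ≠ π.policy ω.1} := by
      rw [← h1, ← M.map_swap_jointLaw β μ₀ π L (t + 1),
        Measure.map_apply hsw (M.measurableSet_policy_ne π (by fun_prop) (by fun_prop)),
        M.map_swap_jointLaw β μ₀ π L (t + 1)]
      rfl
    have hsub : {y : Run Θ S A H L (t + 1) × Θ | π.policy y.2 ≠ π.policy y.1.1} ⊆
        {y | π.policy (y.1.2.2 0).1 ≠ π.policy y.2} ∪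
          {y | π.policy (y.1.2.2 0).1 ≠ π.policy y.1.1} := fun y hy => by
      by_contra hc
      simp only [Set.mem_union, Set.mem_ofPred_eq, not_or, not_not] at hc hy
      exact hy (hc.1.symm.trans hc.2)
    have h3 := (measureReal_mono (μ := M.jointLaw β μ₀ π L (t + 1)) hsub).trans
      (measureReal_union_le _ _)
    simp only [measureReal_def, h1, h2] at h3
    rw [two_mul]
    exact h3

end Misselection

/-! ### Visit counts and concentration of the empirical transitions. -/

section Concentration

variable {Θ S A : Type*} [MeasurableSpace Θ] [Fintype S] [Fintype A] {H : ℕ}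

/-- The online episodes of a run. -/
def onlineData {L t : ℕ} (ω : Run Θ S A H L t) : Fin t → Episode S A H := fun j => (ω.2.2 j).2

theorem onlineData_extendRun {L t : ℕ} (y : Run Θ S A H L t × Θ) (e : Episode S A H) :
    onlineData (extendRun y e) = Fin.snoc (α := fun _ => Episode S A H) (onlineData y.1) e := by
  funext j
  induction j using Fin.lastCases with
  | last => simp only [onlineData, extendRun, Fin.snoc_last]
  | cast i => simp only [onlineData, extendRun, Fin.snoc_castSucc]

theorem measurable_onlineData (L t : ℕ) :
    Measurable (onlineData : Run Θ S A H L t → Fin t → Episode S A H) := by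
  unfold onlineData; fun_prop

theorem measurable_param_onlineData {γ : Type*} [MeasurableSpace γ] {L t : ℕ}
    {g : Θ → (Fin t → Episode S A H) → γ} (hg : ∀ E, Measurable fun θ => g θ E) :
    Measurable fun ω : Run Θ S A H L t => g ω.1 (onlineData ω) := by
  have h : Measurable fun z : Θ × (Fin t → Episode S A H) => g z.1 z.2 :=
    measurable_from_prod_countable_left hg
  exact h.comp (measurable_fst.prodMk (measurable_onlineData L t))

open scoped Classical in
/-- Whether the action `a` is taken in the state `s` in period `h` of the episode. -/
def visit (h : Fin H) (s : S) (a : A) (e : Episode S A H) : ℕ :=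
  if e.state h.castSucc = s ∧ e.action h = a then 1 else 0

/-- The number of visits to a state-action pair in period `h` of the given episodes. -/
def visits {t : ℕ} (E : Fin t → Episode S A H) (h : Fin H) (s : S) (a : A) : ℕ :=
  ∑ j, visit h s a (E j)

theorem visit_le_one (h : Fin H) (s : S) (a : A) (e : Episode S A H) : visit h s a e ≤ 1 := by
  unfold visit; split_ifs <;> simp

theorem visits_le {t : ℕ} (E : Fin t → Episode S A H) (h : Fin H) (s : S) (a : A) :
    visits E h s a ≤ t :=
  (Finset.sum_le_card_nsmul _ _ 1 fun _ _ => visit_le_one _ _ _ _).trans (by simp)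

theorem visits_snoc {t : ℕ} (E : Fin t → Episode S A H) (e : Episode S A H) (h : Fin H) (s : S)
    (a : A) : visits (Fin.snoc (α := fun _ => Episode S A H) E e) h s a =
      visits E h s a + visit h s a e := by
  simp only [visits, Fin.sum_univ_castSucc, Fin.snoc_castSucc, Fin.snoc_last]

open scoped Classical in
/-- The deviation of `σ (next state)` from its mean if the state-action pair is visited. -/
def stepNoise (M : MDPFamily Θ S A H) (θ : Θ) (h : Fin H) (s : S) (a : A) (σ : S → ℝ)
    (e : Episode S A H) : ℝ :=
  if e.state h.castSucc = s ∧ e.action h = a then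
    σ (e.state h.succ) - ∑ s', (M.P θ h s a).1 s' * σ s' else 0

/-- The sum of the deviations `stepNoise`. -/
def noise (M : MDPFamily Θ S A H) (θ : Θ) (h : Fin H) (s : S) (a : A) (σ : S → ℝ) {t : ℕ}
    (E : Fin t → Episode S A H) : ℝ :=
  ∑ j, M.stepNoise θ h s a σ (E j)

theorem noise_snoc (M : MDPFamily Θ S A H) (θ : Θ) (h : Fin H) (s : S) (a : A) (σ : S → ℝ) {t : ℕ}
    (E : Fin t → Episode S A H) (e : Episode S A H) :
    M.noise θ h s a σ (Fin.snoc (α := fun _ => Episode S A H) E e) =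
      M.noise θ h s a σ E + M.stepNoise θ h s a σ e := by
  simp only [noise, Fin.sum_univ_castSucc, Fin.snoc_castSucc, Fin.snoc_last]

theorem measurable_noise (M : MDPFamily Θ S A H) (h : Fin H) (s : S) (a : A) (σ : S → ℝ) {t : ℕ}
    (E : Fin t → Episode S A H) : Measurable fun θ => M.noise θ h s a σ E := by
  refine Finset.measurable_fun_sum _ fun j _ => ?_
  unfold stepNoise
  split_ifs
  · exact measurable_const.sub (Finset.measurable_fun_sum _ fun s' _ =>
      (M.measurable_P_apply h s a s').mul_const _)
  · exact measurable_const

/-- Hoeffding's lemma on `[-1, 1]`, where the variance proxy is `((1 - (-1)) / 2)² = 1`. -/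
theorem sum_mul_exp_le (p : stdSimplex ℝ S) (σ : S → ℝ) (hσ : ∀ s, |σ s| ≤ 1) (l : ℝ) :
    ∑ s, p.1 s * Real.exp (l * (σ s - ∑ s', p.1 s' * σ s')) ≤ Real.exp (l ^ 2 / 2) := by
  let _ : MeasurableSpace S := ⊤
  have : DiscreteMeasurableSpace S := ⟨fun _ => trivial⟩
  let κ : Kernel Unit S := finKernel (fun _ s => p.1 s) fun _ => measurable_const
  have : IsMarkovKernel κ := finKernel_isMarkovKernel _ _ (fun _ => p.2.1) fun _ => p.2.2
  have hint : ∀ f : S → ℝ, ∫ s, f s ∂(κ ()) = ∑ s, p.1 s * f s := fun f =>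
    integral_finKernel _ _ (fun _ => p.2.1) () f
  have h1 := (hasSubgaussianMGF_of_mem_Icc (μ := κ ()) (X := σ) (a := -1) (b := 1)
    (Measurable.of_discrete.aemeasurable) (.of_forall fun s => abs_le.1 (hσ s))).mgf_le l
  rw [mgf, hint, hint] at h1
  refine h1.trans (le_of_eq ?_)
  congr 1
  norm_num

/-- The supermartingale step. If the pair is not visited the exponent is zero; if it is, the next
state follows its transition law and Hoeffding's lemma applies. The policy is arbitrary, so the
learner's adaptivity does no harm. -/
theorem sum_episodeProb_mul_exp_stepNoise_le (M : MDPFamily Θ S A H) (θ : Θ) (π : Policy S A H)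
    (h : Fin H) (s : S) (a : A) (σ : S → ℝ) (hσ : ∀ s, |σ s| ≤ 1) (l : ℝ) :
    ∑ e, M.episodeProb θ π e *
      Real.exp (l * M.stepNoise θ h s a σ e - l ^ 2 / 2 * visit h s a e) ≤ 1 := by
  classical
  have h1 := M.sum_episodeProb_mul_transition θ π h fun s₁ a₁ s' =>
    if s₁ = s ∧ a₁ = a then
      Real.exp (l * (σ s' - ∑ s', (M.P θ h s a).1 s' * σ s') - l ^ 2 / 2) else 1
  refine (le_of_eq ?_).trans (h1.le.trans ?_)
  · refine Finset.sum_congr rfl fun e _ => ?_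
    unfold stepNoise visit
    split_ifs <;> simp
  · refine (Finset.sum_le_sum fun e _ =>
      mul_le_of_le_one_right (M.episodeProb_nonneg θ π e) ?_).trans (M.sum_episodeProb θ π).le
    by_cases hc : e.state h.castSucc = s ∧ e.action h = a
    · simp only [hc.1, hc.2, and_self, if_true, Real.exp_sub, ← mul_div_assoc, ← Finset.sum_div]
      exact (div_le_one (Real.exp_pos _)).2 (sum_mul_exp_le _ σ hσ l)
    · simp only [if_neg hc, mul_one, (M.P θ h _ _).2.2, le_refl]

/-- The `ℓ¹`-norm of the vector of deviations. -/
def deviation (M : MDPFamily Θ S A H) (θ : Θ) (h : Fin H) (s : S) (a : A) {t : ℕ}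
    (E : Fin t → Episode S A H) : ℝ :=
  open scoped Classical in ∑ s', |M.noise θ h s a (Pi.single s' 1) E|

theorem deviation_nonneg (M : MDPFamily Θ S A H) (θ : Θ) (h : Fin H) (s : S) (a : A) {t : ℕ}
    (E : Fin t → Episode S A H) : 0 ≤ M.deviation θ h s a E :=
  Finset.sum_nonneg fun _ _ => abs_nonneg _

theorem measurable_deviation (M : MDPFamily Θ S A H) (h : Fin H) (s : S) (a : A) {t : ℕ}
    (E : Fin t → Episode S A H) : Measurable fun θ => M.deviation θ h s a E :=
  Finset.measurable_fun_sum _ fun _ _ => (M.measurable_noise h s a _ E).abs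

open scoped Classical in
theorem noise_single (M : MDPFamily Θ S A H) (θ : Θ) (h : Fin H) (s : S) (a : A) (s' : S)
    {t : ℕ} (E : Fin t → Episode S A H) :
    M.noise θ h s a (Pi.single s' 1) E =
      (∑ j, if (E j).state h.castSucc = s ∧ (E j).action h = a then
        (Pi.single s' 1 : S → ℝ) ((E j).state h.succ) else 0) -
        visits E h s a * (M.P θ h s a).1 s' := by
  rw [noise, visits, Nat.cast_sum, Finset.sum_mul, ← Finset.sum_sub_distrib]
  refine Finset.sum_congr rfl fun j _ => ?_
  unfold stepNoise visit
  split_ifs <;> simp [Pi.single_apply]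

/-- Both noise vectors are centred at different parameters but share the empirical transition
counts, which cancel in their difference. -/
theorem visits_mul_transDist_le (M : MDPFamily Θ S A H) (θ θ' : Θ) (h : Fin H) (s : S) (a : A)
    {t : ℕ} (E : Fin t → Episode S A H) :
    visits E h s a * M.transDist θ θ' h s a ≤ M.deviation θ h s a E + M.deviation θ' h s a E := by
  classical
  rw [transDist, deviation, deviation, ← Finset.sum_add_distrib, Finset.mul_sum]
  refine Finset.sum_le_sum fun s' _ => ?_
  rw [← abs_of_nonneg (Nat.cast_nonneg (α := ℝ) (visits E h s a)), ← abs_mul, add_comm]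
  refine le_trans (le_of_eq ?_) (abs_sub _ _)
  rw [noise_single, noise_single]
  congr 1
  ring

theorem stepNoise_eq_sum (M : MDPFamily Θ S A H) [DecidableEq S] (θ : Θ) (h : Fin H) (s : S)
    (a : A) (σ : S → ℝ) (e : Episode S A H) : M.stepNoise θ h s a σ e =
      ∑ s', σ s' * M.stepNoise θ h s a (Pi.single s' 1) e := by
  unfold stepNoise
  split_ifs
  · simp only [Pi.single_apply, mul_ite, mul_one, mul_zero, Finset.sum_ite_eq', Finset.mem_univ,
      if_true, mul_sub, Finset.sum_sub_distrib, Finset.sum_ite_eq]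
    simp only [mul_comm]
  · simp

/-- Duality of `ℓ¹` and `ℓ∞`: the noise is linear in `σ`, and the signs of its coordinates attain
the norm. Only `2 ^ card S` choices of `σ` are then needed in the union bound. -/
theorem exists_deviation_eq_noise (M : MDPFamily Θ S A H) (θ : Θ) (h : Fin H) (s : S) (a : A)
    {t : ℕ} (E : Fin t → Episode S A H) :
    ∃ b : S → Bool, M.deviation θ h s a E =
      M.noise θ h s a (fun s' => if b s' then 1 else -1) E := by
  classical
  refine ⟨fun s' => decide (0 ≤ M.noise θ h s a (Pi.single s' 1) E), ?_⟩
  have h1 : ∀ σ, M.noise θ h s a σ E = ∑ s', σ s' * M.noise θ h s a (Pi.single s' 1) E :=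
    fun σ => by
      simp only [noise, Finset.mul_sum]
      rw [Finset.sum_comm]
      exact Finset.sum_congr rfl fun j _ => M.stepNoise_eq_sum θ h s a σ (E j)
  rw [h1, deviation]
  refine Finset.sum_congr rfl fun s' _ => ?_
  by_cases hc : 0 ≤ M.noise θ h s a (Pi.single s' 1) E
  · simp [hc, abs_of_nonneg hc]
  · simp [hc, abs_of_neg (not_le.1 hc)]

/-- The parameter `θ` is implausible at `(h, s, a)`, given the online episodes. -/
def implausible (M : MDPFamily Θ S A H) (T : ℕ) (h : Fin H) (s : S) (a : A) (t : ℕ) :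
    Set (Θ × (Fin t → Episode S A H)) :=
  {z | 1 ≤ visits z.2 h s a ∧
    16 * (Fintype.card S + Real.log T) * visits z.2 h s a < M.deviation z.1 h s a z.2 ^ 2}

theorem measurableSet_implausible (M : MDPFamily Θ S A H) (T : ℕ) (h : Fin H) (s : S) (a : A)
    (t : ℕ) : MeasurableSet (M.implausible T h s a t) := by
  have h1 : Measurable fun z : Θ × (Fin t → Episode S A H) => M.deviation z.1 h s a z.2 :=
    measurable_from_prod_countable_left fun E => M.measurable_deviation h s a E
  have h2 : Measurable fun z : Θ × (Fin t → Episode S A H) => visits z.2 h s a :=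
    (Measurable.of_discrete (f := fun E : Fin t → Episode S A H => visits E h s a)).comp
      measurable_snd
  refine (measurableSet_le measurable_const h2).inter (measurableSet_lt ?_ (h1.pow_const 2))
  exact (measurable_from_top.comp h2).const_mul _

variable [Nonempty A]

/-- The one-step bound makes this exponential a supermartingale started at 1, for the noise centred
at the true parameter. The compensator runs with the visits, not with time. -/
theorem lintegral_exp_noise_le (M : MDPFamily Θ S A H) (β : ℝ) (μ₀ : Measure Θ)
    [IsProbabilityMeasure μ₀] (π : M.OptimalSelection) (L t : ℕ) (h : Fin H) (s : S) (a : A)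
    (σ : S → ℝ) (hσ : ∀ s, |σ s| ≤ 1) (l : ℝ) :
    ∫⁻ ω, ENNReal.ofReal (Real.exp (l * M.noise ω.1 h s a σ (onlineData ω) -
      l ^ 2 / 2 * visits (onlineData ω) h s a)) ∂(M.runLaw β μ₀ π L t) ≤ 1 := by
  have hm : ∀ t, Measurable fun ω : Run Θ S A H L t =>
      ENNReal.ofReal (Real.exp (l * M.noise ω.1 h s a σ (onlineData ω) -
        l ^ 2 / 2 * visits (onlineData ω) h s a)) := fun t =>
    measurable_param_onlineData
      (g := fun θ E => ENNReal.ofReal (Real.exp (l * M.noise θ h s a σ E -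
        l ^ 2 / 2 * visits E h s a))) fun E =>
      (((M.measurable_noise h s a σ E).const_mul l).sub_const _).exp.ennreal_ofReal
  induction t with
  | zero => simp [noise, visits]
  | succ t ih =>
    rw [M.lintegral_runLaw_succ β μ₀ π L t (hm _)]
    refine le_trans (lintegral_mono fun y => ?_)
      ((M.lintegral_jointLaw_fst β μ₀ π L t (hm t)).le.trans ih)
    simp only [onlineData_extendRun, noise_snoc, visits_snoc]
    simp only [← ENNReal.ofReal_mul (M.episodeProb_nonneg _ _ _)]
    rw [← ENNReal.ofReal_sum_of_nonneg fun e _ =>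
      mul_nonneg (M.episodeProb_nonneg _ _ _) (Real.exp_pos _).le]
    refine ENNReal.ofReal_le_ofReal ?_
    have h1 := M.sum_episodeProb_mul_exp_stepNoise_le y.1.1 (π.policy y.2) h s a σ hσ l
    calc _ = Real.exp (l * M.noise y.1.1 h s a σ (onlineData y.1) -
            l ^ 2 / 2 * visits (onlineData y.1) h s a) * ∑ e, M.episodeProb y.1.1 (π.policy y.2) e *
          Real.exp (l * M.stepNoise y.1.1 h s a σ e - l ^ 2 / 2 * visit h s a e) := by
          rw [Finset.mul_sum]
          refine Finset.sum_congr rfl fun e _ => ?_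
          rw [mul_left_comm, ← Real.exp_add]
          congr 2
          simp only [extendRun]
          push_cast
          ring
      _ ≤ _ := mul_le_of_le_one_right (Real.exp_pos _).le h1

/-- The true parameter is rarely implausible. -/
theorem runLaw_implausible_le (M : MDPFamily Θ S A H) (β : ℝ) (μ₀ : Measure Θ)
    [IsProbabilityMeasure μ₀] (π : M.OptimalSelection) (L : ℕ) {t T : ℕ} (htT : t ≤ T)
    (hT : 1 ≤ T) (h : Fin H) (s : S) (a : A) :
    (M.runLaw β μ₀ π L t).real {ω | (ω.1, onlineData ω) ∈ M.implausible T h s a t} ≤ 1 / T := by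
  classical
  set X : ℝ := Fintype.card S + Real.log T with hX
  have hT1 : (1 : ℝ) ≤ T := by exact_mod_cast hT
  have hlog : 0 ≤ Real.log T := Real.log_nonneg hT1
  have hX0 : 0 ≤ X := by positivity
  let sg : (S → Bool) → S → ℝ := fun b s' => if b s' then 1 else -1
  have hsg : ∀ b s', |sg b s'| ≤ 1 := fun b s' => by
    simp only [sg]; split_ifs <;> simp
  -- The tilt `√(X / n)` is tuned to `n` visits. Since the visit count is random and the tilt must
  -- be deterministic, the union runs over all counts `n ≤ T` as well as over the sign vectors.
  let Z : ℕ → (S → Bool) → Run Θ S A H L t → ENNReal := fun n b ω =>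
    ENNReal.ofReal (Real.exp (√(X / n) * M.noise ω.1 h s a (sg b) (onlineData ω) -
      √(X / n) ^ 2 / 2 * visits (onlineData ω) h s a))
  have hZm : ∀ n b, Measurable (Z n b) := fun n b =>
    measurable_param_onlineData
      (g := fun θ E => ENNReal.ofReal (Real.exp (√(X / n) * M.noise θ h s a (sg b) E -
        √(X / n) ^ 2 / 2 * visits E h s a))) fun E =>
      (((M.measurable_noise h s a _ E).const_mul _).sub_const _).exp.ennreal_ofReal
  have hms : MeasurableSet
      {ω : Run Θ S A H L t | (ω.1, onlineData ω) ∈ M.implausible T h s a t} :=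
    (M.measurableSet_implausible T h s a t).preimage
      (measurable_fst.prodMk (measurable_onlineData L t))
  have key : M.runLaw β μ₀ π L t {ω | (ω.1, onlineData ω) ∈ M.implausible T h s a t} ≤
      ENNReal.ofReal (1 / T) := by
    calc _ = ∫⁻ ω, Set.indicator
          {ω : Run Θ S A H L t | (ω.1, onlineData ω) ∈ M.implausible T h s a t} 1 ω
            ∂(M.runLaw β μ₀ π L t) := (lintegral_indicator_one hms).symm
      _ ≤ ∫⁻ ω, ∑ n ∈ Finset.Icc 1 T, ∑ b, ENNReal.ofReal (Real.exp (-(3 * X))) * Z n b ω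
            ∂(M.runLaw β μ₀ π L t) := by
          refine lintegral_mono fun ω => ?_
          by_cases hω : (ω.1, onlineData ω) ∈ M.implausible T h s a t
          · rw [Set.indicator_apply, if_pos (show ω ∈ _ from hω)]
            obtain ⟨h1, h2⟩ := hω
            simp only at h1 h2
            rw [← hX] at h2
            obtain ⟨b, hb⟩ := M.exists_deviation_eq_noise ω.1 h s a (onlineData ω)
            set n := visits (onlineData ω) h s a with hn
            have hnT : n ∈ Finset.Icc 1 T := Finset.mem_Icc.2 ⟨h1, (visits_le _ _ _ _).trans htT⟩
            have hn0 : (0 : ℝ) < n := by exact_mod_cast h1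
            refine le_trans ?_ (Finset.single_le_sum (f := fun n => ∑ b,
              ENNReal.ofReal (Real.exp (-(3 * X))) * Z n b ω) (fun _ _ => zero_le) hnT)
            refine le_trans ?_ (Finset.single_le_sum (f := fun b =>
              ENNReal.ofReal (Real.exp (-(3 * X))) * Z n b ω) (fun _ _ => zero_le)
              (Finset.mem_univ b))
            simp only [Z, sg]
            rw [← ENNReal.ofReal_mul (Real.exp_pos _).le, ← Real.exp_add, ← hb, Pi.one_apply,
              ← ENNReal.ofReal_one]
            refine ENNReal.ofReal_le_ofReal (Real.one_le_exp ?_)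
            have h3 : √(X / n) ^ 2 = X / n := Real.sq_sqrt (by positivity)
            -- The constant 16 of `implausible` enters as `4 = √16`. With the compensator `X / 2` of
            -- `h5` the exponent is at least `-3X + 4X - X/2 ≥ 0`.
            have h4 : 4 * X ≤ √(X / n) * M.deviation ω.1 h s a (onlineData ω) := by
              refine le_of_sq_le_sq ?_
                (mul_nonneg (Real.sqrt_nonneg _) (M.deviation_nonneg _ _ _ _ _))
              rw [mul_pow, mul_pow, h3]
              calc (4 : ℝ) ^ 2 * X ^ 2 = X / n * (16 * X * n) := by field_simp; ring
                _ ≤ _ := mul_le_mul_of_nonneg_left h2.le (by positivity)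
            have h5 : √(X / n) ^ 2 / 2 * (n : ℝ) = X / 2 := by rw [h3]; field_simp
            rw [h5]; linarith
          · rw [Set.indicator_apply, if_neg (show ω ∉ _ from hω)]; exact zero_le
      _ = ∑ n ∈ Finset.Icc 1 T, ∑ b, ENNReal.ofReal (Real.exp (-(3 * X))) *
            ∫⁻ ω, Z n b ω ∂(M.runLaw β μ₀ π L t) := by
          rw [lintegral_finsetSum _ fun n _ => Finset.measurable_fun_sum _ fun b _ =>
            (hZm n b).const_mul _]
          refine Finset.sum_congr rfl fun n _ => ?_
          rw [lintegral_finsetSum _ fun b _ => (hZm n b).const_mul _]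
          exact Finset.sum_congr rfl fun b _ => lintegral_const_mul _ (hZm n b)
      _ ≤ ∑ _n ∈ Finset.Icc 1 T, ∑ _b : S → Bool, ENNReal.ofReal (Real.exp (-(3 * X))) :=
          Finset.sum_le_sum fun n _ => Finset.sum_le_sum fun b _ =>
            mul_le_of_le_one_right (zero_le)
              (M.lintegral_exp_noise_le β μ₀ π L t h s a (sg b) (hsg b) _)
      _ = ENNReal.ofReal (T * (2 ^ Fintype.card S * Real.exp (-(3 * X)))) := by
          rw [Finset.sum_const, Finset.sum_const, Nat.card_Icc, Finset.card_univ, Fintype.card_fun,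
            Fintype.card_bool, nsmul_eq_mul, nsmul_eq_mul, ENNReal.ofReal_mul (by positivity),
            ENNReal.ofReal_mul (by positivity), ENNReal.ofReal_natCast,
            ENNReal.ofReal_pow (by norm_num)]
          simp
      _ ≤ _ := by
          refine ENNReal.ofReal_le_ofReal ?_
          have e1 : (2 : ℝ) ^ Fintype.card S ≤ Real.exp (Fintype.card S) := by
            rw [← Real.exp_one_pow]
            exact pow_le_pow_left₀ (by norm_num) Real.exp_one_gt_two.le _
          have e2 : Real.exp (Real.log T) = T := Real.exp_log (by linarith)
          -- `exp (-3X)` absorbs the number of sign vectors and leaves `1 / T ^ 2`; one factor `T`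
          -- pays for the union over counts.
          have e3 : (2 : ℝ) ^ Fintype.card S * Real.exp (-(3 * X)) ≤ 1 / T ^ 2 := by
            calc _ ≤ Real.exp (Fintype.card S) * Real.exp (-(3 * X)) :=
                  mul_le_mul_of_nonneg_right e1 (Real.exp_pos _).le
              _ ≤ Real.exp (-(Real.log T + Real.log T)) := by
                  rw [← Real.exp_add]
                  have : (0 : ℝ) ≤ Fintype.card S := Nat.cast_nonneg _
                  exact Real.exp_le_exp.2 (by rw [hX]; linarith)
              _ = _ := by rw [Real.exp_neg, Real.exp_add, e2, one_div, sq]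
          calc (T : ℝ) * (2 ^ Fintype.card S * Real.exp (-(3 * X))) ≤ T * (1 / T ^ 2) :=
                mul_le_mul_of_nonneg_left e3 (by linarith)
            _ = 1 / T := by field_simp
  rw [measureReal_def]
  exact ENNReal.toReal_le_of_le_ofReal (by positivity) key

end Concentration

end MDPFamily

/-! ### Elementary inequalities and the sum of inverse counts. -/

theorem abs_sub_le_of_mem_Icc {x y b : ℝ} (hx : x ∈ Set.Icc 0 b) (hy : y ∈ Set.Icc 0 b) :
    |x - y| ≤ b :=
  abs_le.2 ⟨by linarith [hx.1, hy.2], by linarith [hx.2, hy.1]⟩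

/-- Replaces Cauchy–Schwarz: bounds linear in `η` and `η⁻¹` can be added over rounds and integrated,
with `η` optimized once at the end. -/
theorem le_two_mul_sqrt_mul {x a b : ℝ} (ha : 0 ≤ a) (hb : 0 ≤ b)
    (h : ∀ η : ℝ, 0 < η → x ≤ η * a + η⁻¹ * b) : x ≤ 2 * √(a * b) := by
  rcases le_or_gt x 0 with hx | hx
  · exact hx.trans (by positivity)
  have key : (x / 2) ^ 2 ≤ a * b := by
    rcases hb.eq_or_lt with rfl | hb
    · have h1 := h (x / (2 * (a + 1))) (by positivity)
      have h2 : x / (2 * (a + 1)) * a ≤ x / 2 := by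
        rw [div_mul_eq_mul_div, div_le_div_iff₀ (by positivity) (by norm_num)]
        nlinarith
      rw [mul_zero] at h1
      linarith
    -- This `η` makes the second term exactly `x / 2`, so the first is at least `x / 2`.
    · have h1 := h (2 * b / x) (by positivity)
      have h2 : 2 * b / x * a + (2 * b / x)⁻¹ * b = 2 * (a * b) / x + x / 2 := by
        field_simp
      rw [h2] at h1
      have h3 : x / 2 ≤ 2 * (a * b) / x := by linarith
      rw [le_div_iff₀ hx] at h3
      nlinarith
  have := Real.le_sqrt_of_sq_le key
  linarith

theorem integral_le_of_forall_le {X : Type*} [MeasurableSpace X] {μ : Measure X}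
    {f f₁ f₂ f₃ f₄ : X → ℝ} (hf : Integrable f μ) (h₁ : Integrable f₁ μ) (h₂ : Integrable f₂ μ)
    (h₃ : Integrable f₃ μ) (h₄ : Integrable f₄ μ) {a b : ℝ}
    (h : ∀ x, f x ≤ a * (f₁ x - f₂ x) + b * (f₃ x + f₄ x)) :
    ∫ x, f x ∂μ ≤ a * (∫ x, f₁ x ∂μ - ∫ x, f₂ x ∂μ) + b * (∫ x, f₃ x ∂μ + ∫ x, f₄ x ∂μ) := by
  have h₁₂ : Integrable (fun x => a * (f₁ x - f₂ x)) μ := (h₁.sub h₂).const_mul a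
  have h₃₄ : Integrable (fun x => b * (f₃ x + f₄ x)) μ := (h₃.add h₄).const_mul b
  rw [← integral_sub h₁ h₂, ← integral_add h₃ h₄, ← integral_const_mul, ← integral_const_mul,
    ← integral_add h₁₂ h₃₄]
  exact integral_mono hf (h₁₂.add h₃₄) h

/-- A potential whose increments are the inverse visit counts. -/
def invSum (n : ℕ) : ℝ := ∑ k ∈ Finset.range n, 1 / max 1 (k : ℝ)

theorem invSum_nonneg (n : ℕ) : 0 ≤ invSum n :=
  Finset.sum_nonneg fun _ _ => by positivity

theorem invSum_mono : Monotone invSum := fun _ _ h =>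
  Finset.sum_le_sum_of_subset_of_nonneg (Finset.range_mono h) fun _ _ _ => by positivity

theorem invSum_le {T : ℕ} (hT : 1 ≤ T) : invSum T ≤ 2 + Real.log T := by
  obtain ⟨n, rfl⟩ : ∃ n, T = n + 1 := ⟨T - 1, by omega⟩
  -- The extra 1 is the term `k = 0`, where the maximum replaces a count of zero by one.
  have h1 : invSum (n + 1) = (harmonic n : ℚ) + 1 := by
    rw [invSum, Finset.sum_range_succ', harmonic]
    push_cast
    congr 1
    · refine Finset.sum_congr rfl fun k _ => ?_
      rw [max_eq_right (by linarith [Nat.cast_nonneg (α := ℝ) k]), one_div]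
    · simp
  have h2 := harmonic_le_one_add_log n
  have h3 : Real.log n ≤ Real.log ((n + 1 : ℕ) : ℝ) := by
    rcases n.eq_zero_or_pos with rfl | hn
    · simp
    · exact Real.log_le_log (by exact_mod_cast hn) (by push_cast; linarith)
  linarith

namespace MDPFamily

/-! ### Squared transition errors, the potential argument and the regret bound. -/

section Regret

variable {Θ S A : Type*} [MeasurableSpace Θ] [Fintype S] [Fintype A] {H : ℕ}

theorem measurable_expReturn {X : Type*} [MeasurableSpace X] (M : MDPFamily Θ S A H) {f : X → Θ}
    (hf : Measurable f) {g : X → Policy S A H} (hg : Measurable g) :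
    Measurable fun x => M.expReturn (f x) (g x) :=
  Finset.measurable_fun_sum _ fun e _ => (M.measurable_episodeProb hf hg e).mul_const _

theorem measurable_transDist {X : Type*} [MeasurableSpace X] (M : MDPFamily Θ S A H) {f g : X → Θ}
    (hf : Measurable f) (hg : Measurable g) (h : Fin H) (s : S) (a : A) :
    Measurable fun x => M.transDist (f x) (g x) h s a :=
  Finset.measurable_fun_sum _ fun s' _ =>
    (((M.measurable_P_apply h s a s').comp hf).sub ((M.measurable_P_apply h s a s').comp hg)).abs

/-- The sum of the squared distances between transition probabilities along an episode of the
first MDP. -/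
def sqDist (M : MDPFamily Θ S A H) (θ θ' : Θ) (π : Policy S A H) : ℝ :=
  ∑ e, M.episodeProb θ π e *
    ∑ h : Fin H, M.transDist θ θ' h (e.state h.castSucc) (e.action h) ^ 2

theorem measurable_sqDist {X : Type*} [MeasurableSpace X] (M : MDPFamily Θ S A H) {f f' : X → Θ}
    (hf : Measurable f) (hf' : Measurable f') {g : X → Policy S A H} (hg : Measurable g) :
    Measurable fun x => M.sqDist (f x) (f' x) (g x) :=
  Finset.measurable_fun_sum _ fun e _ => (M.measurable_episodeProb hf hg e).fun_mul
    (Finset.measurable_fun_sum _ fun _ _ => (M.measurable_transDist hf hf' _ _ _).pow_const 2)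

theorem sum_episodeProb_mul_mem_Icc (M : MDPFamily Θ S A H) (θ : Θ) (π : Policy S A H)
    {f : Episode S A H → ℝ} {b : ℝ} (hf : ∀ e, f e ∈ Set.Icc 0 b) :
    ∑ e, M.episodeProb θ π e * f e ∈ Set.Icc 0 b := by
  refine ⟨Finset.sum_nonneg fun e _ => mul_nonneg (M.episodeProb_nonneg _ _ _) (hf e).1, ?_⟩
  calc _ ≤ ∑ e, M.episodeProb θ π e * b := Finset.sum_le_sum fun e _ =>
        mul_le_mul_of_nonneg_left (hf e).2 (M.episodeProb_nonneg _ _ _)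
    _ = b := by rw [← Finset.sum_mul, M.sum_episodeProb, one_mul]

theorem sqDist_mem_Icc (M : MDPFamily Θ S A H) (θ θ' : Θ) (π : Policy S A H) :
    M.sqDist θ θ' π ∈ Set.Icc (0 : ℝ) (H * 4) := by
  refine M.sum_episodeProb_mul_mem_Icc θ π fun e => ⟨Finset.sum_nonneg fun _ _ => sq_nonneg _, ?_⟩
  refine (Finset.sum_le_card_nsmul _ _ 4 fun h _ => ?_).trans (by simp)
  nlinarith [M.transDist_le_two θ θ' h (e.state h.castSucc) (e.action h),
    M.transDist_nonneg θ θ' h (e.state h.castSucc) (e.action h)]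

/-- The simulation lemma with `w ≤ (η + w² / η) / 2` applied to each of the `H` transition errors.
Episodes are weighted by the first MDP, which will be the true one. -/
theorem expReturn_sub_le_sqDist (M : MDPFamily Θ S A H) (θ θ' : Θ) (π : Policy S A H) {η : ℝ}
    (hη : 0 < η) : M.expReturn θ' π - M.expReturn θ π ≤
      H / 2 * (η * H + η⁻¹ * M.sqDist θ θ' π) := by
  have h1 := (abs_le.1 (M.abs_expReturn_sub_expReturn_le θ θ' π)).1
  have h2 : ∀ w : ℝ, w ≤ 1 / 2 * (η + η⁻¹ * w ^ 2) := fun w => by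
    have h3 : 0 ≤ η⁻¹ * (w - η) ^ 2 := by positivity
    have h4 : η⁻¹ * (w - η) ^ 2 = η⁻¹ * w ^ 2 - 2 * w + η := by field_simp; ring
    linarith
  have h5 : ∑ e, M.episodeProb θ π e *
      ∑ h : Fin H, M.transDist θ θ' h (e.state h.castSucc) (e.action h) ≤
      1 / 2 * (η * H + η⁻¹ * M.sqDist θ θ' π) := by
    calc _ ≤ ∑ e, M.episodeProb θ π e * (1 / 2 * (η * H + η⁻¹ *
          ∑ h : Fin H, M.transDist θ θ' h (e.state h.castSucc) (e.action h) ^ 2)) := by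
          refine Finset.sum_le_sum fun e _ =>
            mul_le_mul_of_nonneg_left ?_ (M.episodeProb_nonneg _ _ _)
          refine (Finset.sum_le_sum fun h _ => h2 _).trans (le_of_eq ?_)
          rw [← Finset.mul_sum, Finset.sum_add_distrib, ← Finset.mul_sum]
          simp [mul_comm]
      _ = _ := by
          rw [sqDist]
          simp only [mul_add, Finset.sum_add_distrib,
            Finset.mul_sum (s := Finset.univ (α := Episode S A H))]
          rw [← Finset.sum_mul, M.sum_episodeProb, one_mul]
          congr 1
          exact Finset.sum_congr rfl fun e _ => by ring
  calc _ ≤ H * (1 / 2 * (η * H + η⁻¹ * M.sqDist θ θ' π)) := by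
        linarith [mul_le_mul_of_nonneg_left h5 (Nat.cast_nonneg (α := ℝ) H)]
    _ = _ := by ring

/-- The sum over all state-action pairs of the potentials of the visit counts. -/
def potential {t : ℕ} (E : Fin t → Episode S A H) : ℝ :=
  ∑ h : Fin H, ∑ s : S, ∑ a : A, invSum (visits E h s a)

theorem potential_nonneg {t : ℕ} (E : Fin t → Episode S A H) : 0 ≤ potential E :=
  Finset.sum_nonneg fun _ _ => Finset.sum_nonneg fun _ _ => Finset.sum_nonneg fun _ _ =>
    invSum_nonneg _

theorem potential_le {t : ℕ} (E : Fin t → Episode S A H) :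
    potential E ≤ H * Fintype.card S * Fintype.card A * invSum t := by
  calc _ ≤ ∑ _h : Fin H, ∑ _s : S, ∑ _a : A, invSum t :=
        Finset.sum_le_sum fun h _ => Finset.sum_le_sum fun s _ => Finset.sum_le_sum fun a _ =>
          invSum_mono (visits_le E h s a)
    _ = _ := by simp [mul_assoc]

/-- In each period exactly one state-action pair is visited, and raising its count from `n` to `n +
1` adds `1 / max 1 n`. -/
theorem potential_snoc {t : ℕ} (E : Fin t → Episode S A H) (e : Episode S A H) :
    potential (Fin.snoc (α := fun _ => Episode S A H) E e) = potential E +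
      ∑ h : Fin H, 1 / max 1 (visits E h (e.state h.castSucc) (e.action h) : ℝ) := by
  classical
  rw [potential, potential, ← Finset.sum_add_distrib]
  refine Finset.sum_congr rfl fun h _ => ?_
  have h1 : ∀ s a, invSum (visits (Fin.snoc (α := fun _ => Episode S A H) E e) h s a) =
      invSum (visits E h s a) + if e.action h = a then if e.state h.castSucc = s then
        1 / max 1 (visits E h s a : ℝ) else 0 else 0 := fun s a => by
    rw [visits_snoc, visit]
    by_cases h2 : e.state h.castSucc = s <;> by_cases h3 : e.action h = a <;>
      simp [h2, h3, invSum, Finset.sum_range_succ]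
  simp only [h1, Finset.sum_add_distrib, Finset.sum_ite_eq, Finset.mem_univ, if_true]

/-- If both parameters are plausible and the pair was visited, both deviations are small and so is
the distance, with `64 = 2 * (16 + 16)`. In the remaining cases the trivial bound `2 ^ 2 = 4`
suffices: an indicator equals one, or an unvisited pair makes the first term at least 64. -/
theorem transDist_sq_le (M : MDPFamily Θ S A H) (θ θ' : Θ) (h : Fin H) (s : S) (a : A) {t : ℕ}
    (E : Fin t → Episode S A H) {T : ℕ} (hT : 1 ≤ T) :
    M.transDist θ θ' h s a ^ 2 ≤
      64 * (Fintype.card S + Real.log T) * (1 / max 1 (visits E h s a : ℝ)) +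
        4 * ((M.implausible T h s a t).indicator 1 (θ, E) +
          (M.implausible T h s a t).indicator 1 (θ', E)) := by
  have hS : (1 : ℝ) ≤ Fintype.card S := by
    exact_mod_cast Fintype.card_pos_iff.2 ⟨s⟩
  have hlog : 0 ≤ Real.log T := Real.log_nonneg (by exact_mod_cast hT)
  set X : ℝ := Fintype.card S + Real.log T with hX
  have hX1 : 1 ≤ X := by linarith
  have hW2 := M.transDist_le_two θ θ' h s a
  have hW0 := M.transDist_nonneg θ θ' h s a
  have hW4 : M.transDist θ θ' h s a ^ 2 ≤ 4 := by nlinarith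
  have hi : ∀ z, 0 ≤ (M.implausible T h s a t).indicator (1 : Θ × (Fin t → Episode S A H) → ℝ) z :=
    fun z =>
    Set.indicator_nonneg (fun _ _ => zero_le_one) z
  have hn : (0 : ℝ) ≤ 64 * X * (1 / max 1 (visits E h s a : ℝ)) := by positivity
  by_cases h1 : (θ, E) ∈ M.implausible T h s a t
  · have := hi (θ', E)
    rw [Set.indicator_of_mem h1, Pi.one_apply]
    linarith
  by_cases h2 : (θ', E) ∈ M.implausible T h s a t
  · have := hi (θ, E)
    rw [Set.indicator_of_mem h2, Pi.one_apply]
    linarith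
  rw [Set.indicator_of_notMem h1, Set.indicator_of_notMem h2]
  rcases Nat.eq_zero_or_pos (visits E h s a) with h0 | h0
  · rw [h0]
    simp only [Nat.cast_zero, max_eq_left zero_le_one, div_one]
    linarith
  have hn1 : (1 : ℝ) ≤ visits E h s a := by exact_mod_cast h0
  have h3 : M.deviation θ h s a E ^ 2 ≤ 16 * X * visits E h s a := by
    by_contra hc
    exact h1 ⟨h0, not_le.1 hc⟩
  have h4 : M.deviation θ' h s a E ^ 2 ≤ 16 * X * visits E h s a := by
    by_contra hc
    exact h2 ⟨h0, not_le.1 hc⟩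
  have h5 := M.visits_mul_transDist_le θ θ' h s a E
  have h6 : (visits E h s a * M.transDist θ θ' h s a) ^ 2 ≤ 64 * X * visits E h s a :=
    calc _ ≤ (M.deviation θ h s a E + M.deviation θ' h s a E) ^ 2 :=
          pow_le_pow_left₀ (mul_nonneg (by linarith) hW0) h5 2
      _ ≤ 2 * (M.deviation θ h s a E ^ 2 + M.deviation θ' h s a E ^ 2) := add_sq_le
      _ ≤ _ := by linarith
  rw [max_eq_right hn1, mul_one_div]
  simp only [add_zero, mul_zero]
  rw [le_div_iff₀ (by linarith)]
  have h7 : (0 : ℝ) < visits E h s a := by linarith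
  rw [mul_pow] at h6
  refine le_of_mul_le_mul_left ?_ h7
  linarith

/-- The implausibility of a parameter, summed over all state-action pairs. -/
def implausibility (M : MDPFamily Θ S A H) (T : ℕ) {t : ℕ} (θ : Θ) (E : Fin t → Episode S A H) :
    ℝ :=
  ∑ h : Fin H, ∑ s : S, ∑ a : A, (M.implausible T h s a t).indicator 1 (θ, E)

/-- Along an episode the inverse counts add up to the increment of the potential. With `θ` true and
`π` the sampled policy, the average is over the law of the next episode, so these bounds telescope
over rounds. -/
theorem sqDist_le (M : MDPFamily Θ S A H) (θ θ' : Θ) (π : Policy S A H) {t : ℕ}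
    (E : Fin t → Episode S A H) {T : ℕ} (hT : 1 ≤ T) :
    M.sqDist θ θ' π ≤ 64 * (Fintype.card S + Real.log T) * (∑ e, M.episodeProb θ π e *
        potential (Fin.snoc (α := fun _ => Episode S A H) E e) - potential E) +
      4 * (M.implausibility T θ E + M.implausibility T θ' E) := by
  have hind : ∀ θ (e : Episode S A H), ∑ h : Fin H, (M.implausible T h (e.state h.castSucc)
      (e.action h) t).indicator (1 : Θ × (Fin t → Episode S A H) → ℝ) (θ, E) ≤
        M.implausibility T θ E := fun θ e => by
    have h0 : ∀ (h : Fin H) (s : S) (a : A),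
        0 ≤ (M.implausible T h s a t).indicator (1 : Θ × (Fin t → Episode S A H) → ℝ) (θ, E) :=
      fun h s a => Set.indicator_nonneg (fun _ _ => zero_le_one) _
    refine Finset.sum_le_sum fun h _ => ?_
    refine le_trans ?_ (Finset.single_le_sum (f := fun s => ∑ a,
      (M.implausible T h s a t).indicator (1 : Θ × (Fin t → Episode S A H) → ℝ) (θ, E))
      (fun s _ => Finset.sum_nonneg fun a _ => h0 h s a) (Finset.mem_univ (e.state h.castSucc)))
    exact Finset.single_le_sum (f := fun a => (M.implausible T h (e.state h.castSucc) a t).indicator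
      (1 : Θ × (Fin t → Episode S A H) → ℝ) (θ, E))
      (fun a _ => h0 h _ a) (Finset.mem_univ (e.action h))
  have h1 : ∀ e : Episode S A H,
      ∑ h : Fin H, M.transDist θ θ' h (e.state h.castSucc) (e.action h) ^ 2 ≤
      64 * (Fintype.card S + Real.log T) *
        (potential (Fin.snoc (α := fun _ => Episode S A H) E e) - potential E) +
      4 * (M.implausibility T θ E + M.implausibility T θ' E) := fun e => by
    refine (Finset.sum_le_sum fun h _ => M.transDist_sq_le θ θ' h _ _ E hT).trans ?_
    rw [potential_snoc, add_sub_cancel_left, Finset.sum_add_distrib, ← Finset.mul_sum,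
      ← Finset.mul_sum, Finset.sum_add_distrib]
    linarith [hind θ e, hind θ' e]
  refine (Finset.sum_le_sum fun e _ => mul_le_mul_of_nonneg_left (h1 e)
    (M.episodeProb_nonneg θ π e)).trans (le_of_eq ?_)
  simp only [mul_add, mul_sub, Finset.sum_add_distrib, Finset.sum_sub_distrib]
  simp only [mul_left_comm (M.episodeProb θ π _), ← Finset.mul_sum, ← Finset.sum_mul,
    M.sum_episodeProb, one_mul]

variable [Nonempty A]

theorem integral_jointLaw_fst (M : MDPFamily Θ S A H) (β : ℝ) (μ₀ : Measure Θ)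
    [IsProbabilityMeasure μ₀] (π : M.OptimalSelection) (L t : ℕ)
    {f : Run Θ S A H L t → ℝ} (hf : Measurable f) :
    ∫ y, f y.1 ∂(M.jointLaw β μ₀ π L t) = ∫ ω, f ω ∂(M.runLaw β μ₀ π L t) := by
  have h : M.runLaw β μ₀ π L t = (M.jointLaw β μ₀ π L t).map Prod.fst := by
    rw [jointLaw, ← Measure.fst, Measure.fst_compProd]
  rw [h, integral_map measurable_fst.aemeasurable hf.aestronglyMeasurable]

theorem integral_jointLaw_swap (M : MDPFamily Θ S A H) (β : ℝ) (μ₀ : Measure Θ)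
    [IsProbabilityMeasure μ₀] (π : M.OptimalSelection) (L t : ℕ)
    {f : Run Θ S A H L t × Θ → ℝ} (hf : Measurable f) :
    ∫ y, f ((y.2, y.1.2), y.1.1) ∂(M.jointLaw β μ₀ π L t) =
      ∫ y, f y ∂(M.jointLaw β μ₀ π L t) := by
  have hs : Measurable fun y : Run Θ S A H L t × Θ =>
      (((y.2, y.1.2), y.1.1) : Run Θ S A H L t × Θ) := by fun_prop
  conv_rhs => rw [← M.map_swap_jointLaw β μ₀ π L t]
  rw [integral_map hs.aemeasurable hf.aestronglyMeasurable]

theorem measurable_runRegret (M : MDPFamily Θ S A H) (L T : ℕ) :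
    Measurable (M.runRegret : Run Θ S A H L T → ℝ) := by
  refine Finset.measurable_fun_sum _ fun t _ => ?_
  have h : Measurable fun z : Θ × Episode S A H => M.optV z.1 0 (z.2.state 0) - M.totalReward z.2 :=
    measurable_from_prod_countable_left fun e =>
      (M.measurable_optV 0 (e.state 0)).sub_const (M.totalReward e)
  exact h.comp (f := fun ω : Run Θ S A H L T => (ω.1, (ω.2.2 t).2)) (by fun_prop)

theorem abs_runRegret_le (M : MDPFamily Θ S A H) {L T : ℕ} (ω : Run Θ S A H L T) :
    |M.runRegret ω| ≤ T * (H + 1) := by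
  refine (Finset.abs_sum_le_sum_abs _ _).trans ?_
  refine (Finset.sum_le_card_nsmul _ _ ((H : ℝ) + 1) fun t _ => ?_).trans (by simp [mul_add])
  refine abs_sub_le_of_mem_Icc ?_ (M.totalReward_mem_Icc _)
  simpa using M.optV_mem_Icc ω.1 0 ((ω.2.2 t).2.state 0)

theorem integrable_runRegret (M : MDPFamily Θ S A H) (β : ℝ) (μ₀ : Measure Θ)
    [IsProbabilityMeasure μ₀] (π : M.OptimalSelection) (L T : ℕ) :
    Integrable M.runRegret (M.runLaw β μ₀ π L T) :=
  integrable_of_abs_le (M.measurable_runRegret L T) M.abs_runRegret_le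

/-- The Bayesian regret of the episode that follows the first `t` episodes. -/
def roundRegret (M : MDPFamily Θ S A H) (β : ℝ) (μ₀ : Measure Θ) (π : M.OptimalSelection)
    (L t : ℕ) : ℝ :=
  ∫ y, (M.expReturn y.1.1 (π.policy y.1.1) - M.expReturn y.1.1 (π.policy y.2))
    ∂(M.jointLaw β μ₀ π L t)

theorem runRegret_extendRun (M : MDPFamily Θ S A H) {L t : ℕ} (y : Run Θ S A H L t × Θ)
    (e : Episode S A H) : M.runRegret (extendRun y e) =
      M.runRegret y.1 + (M.optV y.1.1 0 (e.state 0) - M.totalReward e) := by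
  simp only [runRegret, extendRun, Fin.sum_univ_castSucc, Fin.snoc_castSucc, Fin.snoc_last]

/-- Averaging over the new episode turns the realized reward into the return of the sampled policy.
The optimal value at the initial state becomes the return of the selected policy of the true
parameter. -/
theorem bayesRegret_succ (M : MDPFamily Θ S A H) (β : ℝ) (μ₀ : Measure Θ)
    [IsProbabilityMeasure μ₀] (π : M.OptimalSelection) (L t : ℕ) :
    M.bayesRegret β μ₀ π L (t + 1) = M.bayesRegret β μ₀ π L t + M.roundRegret β μ₀ π L t := by
  have h1 : ∀ y : Run Θ S A H L t × Θ,
      ∑ e, M.episodeProb y.1.1 (π.policy y.2) e * M.runRegret (extendRun y e) =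
      M.runRegret y.1 +
        (M.expReturn y.1.1 (π.policy y.1.1) - M.expReturn y.1.1 (π.policy y.2)) := fun y => by
    simp only [runRegret_extendRun, mul_add, mul_sub, Finset.sum_add_distrib,
      Finset.sum_sub_distrib, ← Finset.sum_mul, M.sum_episodeProb, one_mul]
    rw [M.sum_episodeProb_mul_init, (π.isOptimal y.1.1).expReturn_eq, expReturn]
  rw [bayesRegret, M.integral_runLaw_succ β μ₀ π L t (M.measurable_runRegret L (t + 1))
    M.abs_runRegret_le, integral_congr_ae (.of_forall h1), integral_add,
    M.integral_jointLaw_fst β μ₀ π L t (M.measurable_runRegret L t)]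
  · rfl
  · exact integrable_of_abs_le ((M.measurable_runRegret L t).comp measurable_fst)
      fun y => M.abs_runRegret_le y.1
  · refine integrable_of_abs_le (B := (H : ℝ) + 1) (Measurable.sub ?_ ?_) fun y =>
      abs_sub_le_of_mem_Icc (M.expReturn_mem_Icc _ _) (M.expReturn_mem_Icc _ _)
    · exact M.measurable_expReturn (by fun_prop) (π.measurable_policy.comp (by fun_prop))
    · exact M.measurable_expReturn (by fun_prop) (π.measurable_policy.comp (by fun_prop))

theorem bayesRegret_eq_sum (M : MDPFamily Θ S A H) (β : ℝ) (μ₀ : Measure Θ)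
    [IsProbabilityMeasure μ₀] (π : M.OptimalSelection) (L T : ℕ) :
    M.bayesRegret β μ₀ π L T = ∑ t ∈ Finset.range T, M.roundRegret β μ₀ π L t := by
  induction T with
  | zero => simp [bayesRegret, runRegret]
  | succ T ih => rw [bayesRegret_succ, ih, Finset.sum_range_succ]

theorem roundRegret_nonneg (M : MDPFamily Θ S A H) (β : ℝ) (μ₀ : Measure Θ)
    (π : M.OptimalSelection) (L t : ℕ) : 0 ≤ M.roundRegret β μ₀ π L t :=
  integral_nonneg fun y => sub_nonneg.2 (π.isOptimal y.1.1 _)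

/-- Regret is incurred only if the sampled policy differs from the optimal one, and it is
controlled by the distance between the sampled and the true transition probabilities. -/
theorem roundRegret_le (M : MDPFamily Θ S A H) (β : ℝ) (μ₀ : Measure Θ) [IsProbabilityMeasure μ₀]
    (π : M.OptimalSelection) (L t : ℕ) {η : ℝ} (hη : 0 < η) :
    M.roundRegret β μ₀ π L t ≤ H / 2 * (η * H * (2 * M.misselectionProb β μ₀ π L) +
      η⁻¹ * ∫ y, M.sqDist y.1.1 y.2 (π.policy y.2) ∂(M.jointLaw β μ₀ π L t)) := by
  set Z : Set (Run Θ S A H L t × Θ) := {y | π.policy y.2 ≠ π.policy y.1.1} with hZ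
  have hZm : MeasurableSet Z := M.measurableSet_policy_ne π (by fun_prop) (by fun_prop)
  have hm1 : Measurable fun y : Run Θ S A H L t × Θ => M.expReturn y.1.1 (π.policy y.1.1) :=
    M.measurable_expReturn (by fun_prop) (π.measurable_policy.comp (by fun_prop))
  have hm2 : Measurable fun y : Run Θ S A H L t × Θ => M.expReturn y.1.1 (π.policy y.2) :=
    M.measurable_expReturn (by fun_prop) (π.measurable_policy.comp (by fun_prop))
  have hm3 : Measurable fun y : Run Θ S A H L t × Θ => M.expReturn y.2 (π.policy y.2) :=
    M.measurable_expReturn (by fun_prop) (π.measurable_policy.comp (by fun_prop))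
  have hms : Measurable fun y : Run Θ S A H L t × Θ => M.sqDist y.1.1 y.2 (π.policy y.2) :=
    M.measurable_sqDist (by fun_prop) (by fun_prop) (π.measurable_policy.comp (by fun_prop))
  have hb : ∀ θ (p : Policy S A H), |M.expReturn θ p| ≤ H + 1 := fun θ p => by
    have := M.expReturn_mem_Icc θ p
    rw [abs_of_nonneg this.1]; exact this.2
  have hi : ∀ {f : Run Θ S A H L t × Θ → ℝ}, Measurable f → (∀ y, |f y| ≤ H + 1) →
      Integrable (Z.indicator f) (M.jointLaw β μ₀ π L t) := fun hf hB =>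
    (integrable_of_abs_le hf hB).indicator hZm
  have his : Integrable (fun y : Run Θ S A H L t × Θ => M.sqDist y.1.1 y.2 (π.policy y.2))
      (M.jointLaw β μ₀ π L t) := integrable_of_abs_le (B := H * 4) hms fun y => by
    have := M.sqDist_mem_Icc y.1.1 y.2 (π.policy y.2)
    rw [abs_of_nonneg this.1]; exact this.2
  have hone : Integrable (Z.indicator fun _ => (1 : ℝ)) (M.jointLaw β μ₀ π L t) :=
    (integrable_const 1).indicator hZm
  calc M.roundRegret β μ₀ π L t
      = ∫ y, (Z.indicator (fun y => M.expReturn y.1.1 (π.policy y.1.1)) y -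
          Z.indicator (fun y => M.expReturn y.1.1 (π.policy y.2)) y)
            ∂(M.jointLaw β μ₀ π L t) := by
        refine integral_congr_ae (.of_forall fun y => ?_)
        by_cases hy : y ∈ Z
        · simp only [Set.indicator_of_mem hy]
        · simp only [Set.indicator_of_notMem hy]
          have : π.policy y.2 = π.policy y.1.1 := not_not.1 hy
          rw [this]; ring
    _ = ∫ y, (Z.indicator (fun y => M.expReturn y.2 (π.policy y.2)) y -
          Z.indicator (fun y => M.expReturn y.1.1 (π.policy y.2)) y)
            ∂(M.jointLaw β μ₀ π L t) := by
        rw [integral_sub (hi hm1 fun y => hb _ _) (hi hm2 fun y => hb _ _),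
          integral_sub (hi hm3 fun y => hb _ _) (hi hm2 fun y => hb _ _),
          -- Only the optimal return is swapped. The event `Z` is symmetric, so its indicator
          -- survives.
          ← M.integral_jointLaw_swap β μ₀ π L t (hm1.indicator hZm)]
        congr 1
        refine integral_congr_ae (.of_forall fun y => ?_)
        classical
        simp only [Set.indicator_apply, hZ, Set.mem_ofPred_eq]
        simp only [ne_comm (a := π.policy y.1.1)]
    _ ≤ ∫ y, H / 2 * (η * H * Z.indicator (fun _ => (1 : ℝ)) y +
          η⁻¹ * M.sqDist y.1.1 y.2 (π.policy y.2)) ∂(M.jointLaw β μ₀ π L t) := by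
        refine integral_mono ((hi hm3 fun y => hb _ _).sub (hi hm2 fun y => hb _ _))
          (((hone.const_mul _).add (his.const_mul _)).const_mul _) fun y => ?_
        by_cases hy : y ∈ Z
        · simp only [Set.indicator_of_mem hy, mul_one]
          exact M.expReturn_sub_le_sqDist _ _ _ hη
        · simp only [Set.indicator_of_notMem hy, mul_zero, zero_add, sub_zero]
          have := (M.sqDist_mem_Icc y.1.1 y.2 (π.policy y.2)).1
          positivity
    _ = H / 2 * (η * H * (M.jointLaw β μ₀ π L t).real Z +
          η⁻¹ * ∫ y, M.sqDist y.1.1 y.2 (π.policy y.2) ∂(M.jointLaw β μ₀ π L t)) := by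
        rw [integral_const_mul, integral_add (hone.const_mul _) (his.const_mul _),
          integral_const_mul, integral_const_mul, integral_indicator_const _ hZm]
        simp
    _ ≤ _ := by
        have := M.jointLaw_ne_le β μ₀ π L t
        gcongr

theorem integral_implausibility_le (M : MDPFamily Θ S A H) (β : ℝ) (μ₀ : Measure Θ)
    [IsProbabilityMeasure μ₀] (π : M.OptimalSelection) (L : ℕ) {t T : ℕ} (htT : t ≤ T)
    (hT : 1 ≤ T) :
    ∫ ω, M.implausibility T ω.1 (onlineData ω) ∂(M.runLaw β μ₀ π L t) ≤
      H * Fintype.card S * Fintype.card A * (1 / T) := by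
  have hms : ∀ h s a, MeasurableSet
      {ω : Run Θ S A H L t | (ω.1, onlineData ω) ∈ M.implausible T h s a t} := fun h s a =>
    (M.measurableSet_implausible T h s a t).preimage
      (measurable_fst.prodMk (measurable_onlineData L t))
  have h1 : ∀ h s a (ω : Run Θ S A H L t),
      (M.implausible T h s a t).indicator (1 : Θ × (Fin t → Episode S A H) → ℝ)
        (ω.1, onlineData ω) =
      Set.indicator {ω : Run Θ S A H L t | (ω.1, onlineData ω) ∈ M.implausible T h s a t}
        (fun _ => (1 : ℝ)) ω := fun h s a ω => rfl
  have h2 : ∀ h s a, Integrable (Set.indicator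
      {ω : Run Θ S A H L t | (ω.1, onlineData ω) ∈ M.implausible T h s a t}
        (fun _ => (1 : ℝ))) (M.runLaw β μ₀ π L t) := fun h s a =>
    (integrable_const 1).indicator (hms h s a)
  simp only [implausibility, h1]
  rw [integral_finsetSum _ fun h _ => integrable_finsetSum _ fun s _ =>
    integrable_finsetSum _ fun a _ => h2 h s a]
  calc _ ≤ ∑ _h : Fin H, ∑ _s : S, ∑ _a : A, 1 / (T : ℝ) := by
        refine Finset.sum_le_sum fun h _ => ?_
        rw [integral_finsetSum _ fun s _ => integrable_finsetSum _ fun a _ => h2 h s a]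
        refine Finset.sum_le_sum fun s _ => ?_
        rw [integral_finsetSum _ fun a _ => h2 h s a]
        refine Finset.sum_le_sum fun a _ => ?_
        rw [integral_indicator_const _ (hms h s a), smul_eq_mul, mul_one]
        exact M.runLaw_implausible_le β μ₀ π L htT hT h s a
    _ = _ := by simp [mul_assoc]

theorem measurable_implausibility (M : MDPFamily Θ S A H) (T L t : ℕ) :
    Measurable fun ω : Run Θ S A H L t => M.implausibility T ω.1 (onlineData ω) :=
  Finset.measurable_fun_sum _ fun h _ => Finset.measurable_fun_sum _ fun s _ =>
    Finset.measurable_fun_sum _ fun a _ =>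
      (measurable_one.indicator (M.measurableSet_implausible T h s a t)).fun_comp
        (measurable_fst.prodMk (measurable_onlineData L t))

theorem abs_implausibility_le (M : MDPFamily Θ S A H) (T : ℕ) {t : ℕ} (θ : Θ)
    (E : Fin t → Episode S A H) :
    |M.implausibility T θ E| ≤ H * Fintype.card S * Fintype.card A := by
  have h1 : ∀ h s a,
      (M.implausible T h s a t).indicator (1 : Θ × (Fin t → Episode S A H) → ℝ) (θ, E) ∈
        Set.Icc (0 : ℝ) 1 := fun h s a =>
    ⟨Set.indicator_nonneg (fun _ _ => zero_le_one) _,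
      Set.indicator_le_self' (fun _ _ => zero_le_one) _⟩
  rw [implausibility, abs_of_nonneg (Finset.sum_nonneg fun h _ => Finset.sum_nonneg fun s _ =>
    Finset.sum_nonneg fun a _ => (h1 h s a).1)]
  calc _ ≤ ∑ _h : Fin H, ∑ _s : S, ∑ _a : A, (1 : ℝ) :=
        Finset.sum_le_sum fun h _ => Finset.sum_le_sum fun s _ => Finset.sum_le_sum fun a _ =>
          (h1 h s a).2
    _ = _ := by simp [mul_assoc]

theorem integral_sqDist_le (M : MDPFamily Θ S A H) (β : ℝ) (μ₀ : Measure Θ)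
    [IsProbabilityMeasure μ₀] (π : M.OptimalSelection) (L : ℕ) {t T : ℕ} (htT : t ≤ T)
    (hT : 1 ≤ T) :
    ∫ y, M.sqDist y.1.1 y.2 (π.policy y.2) ∂(M.jointLaw β μ₀ π L t) ≤
      64 * (Fintype.card S + Real.log T) *
        (∫ ω, potential (onlineData ω) ∂(M.runLaw β μ₀ π L (t + 1)) -
          ∫ ω, potential (onlineData ω) ∂(M.runLaw β μ₀ π L t)) +
      8 * (H * Fintype.card S * Fintype.card A * (1 / T)) := by
  have hpm : ∀ t, Measurable fun ω : Run Θ S A H L t => potential (onlineData ω) := fun t =>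
    (Measurable.of_discrete (f := fun E : Fin t → Episode S A H => potential E)).fun_comp
      (measurable_onlineData L t)
  have hpb : ∀ t (ω : Run Θ S A H L t), potential (onlineData ω) ∈
      Set.Icc (0 : ℝ) (H * Fintype.card S * Fintype.card A * invSum t) := fun t ω =>
    ⟨potential_nonneg _, potential_le _⟩
  have hpa : ∀ t (ω : Run Θ S A H L t), |potential (onlineData ω)| ≤
      H * Fintype.card S * Fintype.card A * invSum t := fun t ω => by
    rw [abs_of_nonneg (hpb t ω).1]; exact (hpb t ω).2
  have hprob : ∀ e, Measurable fun y : Run Θ S A H L t × Θ =>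
      M.episodeProb y.1.1 (π.policy y.2) e := fun e =>
    M.measurable_episodeProb (by fun_prop) (π.measurable_policy.comp (by fun_prop)) e
  have hext : ∀ e, Measurable fun y : Run Θ S A H L t × Θ => extendRun y e := fun e =>
    (measurable_extendRun_uncurry L t).comp
      (f := fun y : Run Θ S A H L t × Θ => (y, e)) (by fun_prop)
  have i1 : Integrable (fun y : Run Θ S A H L t × Θ => M.sqDist y.1.1 y.2 (π.policy y.2))
      (M.jointLaw β μ₀ π L t) := integrable_of_abs_le (B := H * 4)
    (M.measurable_sqDist (by fun_prop) (by fun_prop) (π.measurable_policy.comp (by fun_prop)))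
    fun y => by
      have := M.sqDist_mem_Icc y.1.1 y.2 (π.policy y.2)
      rw [abs_of_nonneg this.1]; exact this.2
  have i2 : Integrable (fun y : Run Θ S A H L t × Θ => ∑ e,
      M.episodeProb y.1.1 (π.policy y.2) e * potential (onlineData (extendRun y e)))
      (M.jointLaw β μ₀ π L t) := by
    refine integrable_of_abs_le (B := H * Fintype.card S * Fintype.card A * invSum (t + 1))
      (Finset.measurable_fun_sum _ fun e _ => (hprob e).fun_mul ((hpm _).comp (hext e) :))
      fun y => ?_
    have := M.sum_episodeProb_mul_mem_Icc y.1.1 (π.policy y.2)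
      fun e => hpb (t + 1) (extendRun y e)
    rw [abs_of_nonneg this.1]; exact this.2
  have i3 : Integrable (fun y : Run Θ S A H L t × Θ => potential (onlineData y.1))
      (M.jointLaw β μ₀ π L t) :=
    integrable_of_abs_le ((hpm t).comp measurable_fst :) fun y => hpa t y.1
  have him := M.measurable_implausibility T L t
  have i4 : Integrable (fun y : Run Θ S A H L t × Θ =>
      M.implausibility T y.1.1 (onlineData y.1)) (M.jointLaw β μ₀ π L t) :=
    integrable_of_abs_le (him.comp measurable_fst :) fun y => M.abs_implausibility_le T _ _
  have hsw : Measurable fun y : Run Θ S A H L t × Θ => ((y.2, y.1.2) : Run Θ S A H L t) := by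
    fun_prop
  have i5 : Integrable (fun y : Run Θ S A H L t × Θ =>
      M.implausibility T y.2 (onlineData y.1)) (M.jointLaw β μ₀ π L t) :=
    integrable_of_abs_le (him.comp hsw :) fun y => M.abs_implausibility_le T _ _
  have e4 : ∫ y, M.implausibility T y.1.1 (onlineData y.1) ∂(M.jointLaw β μ₀ π L t) =
      ∫ ω, M.implausibility T ω.1 (onlineData ω) ∂(M.runLaw β μ₀ π L t) :=
    M.integral_jointLaw_fst β μ₀ π L t him
  -- Implausibility depends on the parameter and the online episodes, and the swap fixes the latter:
  -- the sampled parameter inherits the concentration bound of the true one.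
  have e5 : ∫ y, M.implausibility T y.2 (onlineData y.1) ∂(M.jointLaw β μ₀ π L t) =
      ∫ y, M.implausibility T y.1.1 (onlineData y.1) ∂(M.jointLaw β μ₀ π L t) :=
    M.integral_jointLaw_swap β μ₀ π L t
      (f := fun y => M.implausibility T y.1.1 (onlineData y.1)) (him.comp measurable_fst :)
  have hle := M.integral_implausibility_le β μ₀ π L htT hT
  have e2 := M.integral_runLaw_succ β μ₀ π L t (hpm (t + 1)) (hpa (t + 1))
  have e3 := M.integral_jointLaw_fst β μ₀ π L t (hpm t)
  have h1 := integral_le_of_forall_le i1 i2 i3 i4 i5 (a := 64 * (Fintype.card S + Real.log T))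
    (b := 4) fun y => by
      simp only [onlineData_extendRun]
      exact M.sqDist_le y.1.1 y.2 (π.policy y.2) (onlineData y.1) hT
  rw [e3, e5, e4, ← e2] at h1
  linarith

theorem sum_integral_sqDist_le (M : MDPFamily Θ S A H) (β : ℝ) (μ₀ : Measure Θ)
    [IsProbabilityMeasure μ₀] (π : M.OptimalSelection) (L : ℕ) {T : ℕ} (hT : 1 ≤ T) :
    ∑ t ∈ Finset.range T, ∫ y, M.sqDist y.1.1 y.2 (π.policy y.2) ∂(M.jointLaw β μ₀ π L t) ≤
      136 * (H * (Fintype.card S : ℝ) ^ 2 * Fintype.card A * (1 + Real.log T) ^ 2) := by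
  have hS : (1 : ℝ) ≤ Fintype.card S := by
    obtain ⟨s⟩ : Nonempty S := by
      by_contra hc
      rw [not_nonempty_iff] at hc
      simpa using M.ν.2.2
    exact_mod_cast Fintype.card_pos_iff.2 ⟨s⟩
  have hlog : 0 ≤ Real.log T := Real.log_nonneg (by exact_mod_cast hT)
  have hT0 : (0 : ℝ) < T := by exact_mod_cast hT
  set l := Real.log T with hl
  set c : ℝ := (Fintype.card S : ℝ) with hc
  set K : ℝ := H * c * Fintype.card A with hK
  have hK0 : 0 ≤ K := by positivity
  have h0 : 0 ≤ ∫ ω, potential (onlineData ω) ∂(M.runLaw β μ₀ π L 0) :=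
    integral_nonneg fun ω => potential_nonneg _
  have h1 : ∫ ω, potential (onlineData ω) ∂(M.runLaw β μ₀ π L T) ≤ K * (2 + l) := by
    refine (integral_mono_of_nonneg (.of_forall fun ω => potential_nonneg _)
      (integrable_const (K * (2 + l))) (.of_forall fun ω => ?_)).trans (by simp)
    exact (potential_le _).trans (mul_le_mul_of_nonneg_left (invSum_le hT) hK0)
  calc _ ≤ ∑ t ∈ Finset.range T, (64 * (c + l) *
        (∫ ω, potential (onlineData ω) ∂(M.runLaw β μ₀ π L (t + 1)) -
          ∫ ω, potential (onlineData ω) ∂(M.runLaw β μ₀ π L t)) + 8 * (K * (1 / T))) :=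
        Finset.sum_le_sum fun t ht =>
          M.integral_sqDist_le β μ₀ π L (Finset.mem_range.1 ht).le hT
    _ = 64 * (c + l) * (∫ ω, potential (onlineData ω) ∂(M.runLaw β μ₀ π L T) -
          ∫ ω, potential (onlineData ω) ∂(M.runLaw β μ₀ π L 0)) + 8 * K := by
        rw [Finset.sum_add_distrib, ← Finset.mul_sum, Finset.sum_range_sub
          (fun t => ∫ ω, potential (onlineData ω) ∂(M.runLaw β μ₀ π L t))]
        simp only [Finset.sum_const, Finset.card_range, nsmul_eq_mul]
        field_simp
    -- Both terms become multiples of `K * c * (1 + l) ^ 2`, with `64 * 2 + 8 = 136`.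
    _ ≤ 64 * (c * (1 + l)) * (K * (2 * (1 + l))) + 8 * (K * (c * (1 + l) ^ 2)) := by
        have h2 : c + l ≤ c * (1 + l) := by nlinarith
        have h3 : 1 ≤ c * (1 + l) ^ 2 := by
          have : 1 ≤ (1 + l) ^ 2 := one_le_pow₀ (by linarith)
          nlinarith
        have h4 : 0 ≤ K * (2 * (1 + l)) := by positivity
        have h5 : K * (2 + l) ≤ K * (2 * (1 + l)) := mul_le_mul_of_nonneg_left (by linarith) hK0
        have h6 : K ≤ K * (c * (1 + l) ^ 2) := le_mul_of_one_le_right hK0 h3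
        refine add_le_add ?_ (by linarith)
        calc _ ≤ 64 * (c + l) * (K * (2 * (1 + l))) :=
              mul_le_mul_of_nonneg_left (by linarith) (by positivity)
          _ ≤ _ := mul_le_mul_of_nonneg_right (by linarith) h4
    _ = _ := by rw [hK]; ring

theorem bayesRegret_le (M : MDPFamily Θ S A H) (β : ℝ) (μ₀ : Measure Θ)
    [IsProbabilityMeasure μ₀] (π : M.OptimalSelection) (L : ℕ) {T : ℕ} (hT : 1 ≤ T) :
    M.bayesRegret β μ₀ π L T ≤
      2 * √68 * (√(M.misselectionProb β μ₀ π L * (H : ℝ) ^ 4 * (Fintype.card S : ℝ) ^ 2 *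
        (Fintype.card A : ℝ) * (T : ℝ)) * (1 + Real.log T)) := by
  have hlog : 0 ≤ Real.log T := Real.log_nonneg (by exact_mod_cast hT)
  have hε : 0 ≤ M.misselectionProb β μ₀ π L := measureReal_nonneg
  set ε := M.misselectionProb β μ₀ π L
  -- Summed over rounds, the `η` term has coefficient `H / 2 * H * 2ε * T` and the `η⁻¹` term `H / 2
  -- * 136 * H * …`, whence the 68. Their product carries `H ^ 4`.
  have key := le_two_mul_sqrt_mul (x := M.bayesRegret β μ₀ π L T) (a := H ^ 2 * ε * T)
    (b := 68 * (H ^ 2 * (Fintype.card S : ℝ) ^ 2 * Fintype.card A * (1 + Real.log T) ^ 2))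
    (by positivity) (by positivity) fun η hη => by
      rw [bayesRegret_eq_sum]
      refine (Finset.sum_le_sum fun t _ => M.roundRegret_le β μ₀ π L t hη).trans ?_
      rw [← Finset.mul_sum, Finset.sum_add_distrib, Finset.sum_const, Finset.card_range,
        nsmul_eq_mul, ← Finset.mul_sum]
      have h1 := mul_le_mul_of_nonneg_left (M.sum_integral_sqDist_le β μ₀ π L hT)
        (show 0 ≤ (H : ℝ) / 2 * η⁻¹ by positivity)
      linarith
  refine key.trans (le_of_eq ?_)
  rw [show H ^ 2 * ε * T * (68 * (H ^ 2 * (Fintype.card S : ℝ) ^ 2 * Fintype.card A *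
      (1 + Real.log T) ^ 2)) = 68 * ((ε * (H : ℝ) ^ 4 * (Fintype.card S : ℝ) ^ 2 *
      (Fintype.card A : ℝ) * (T : ℝ)) * (1 + Real.log T) ^ 2) by ring,
    Real.sqrt_mul (by norm_num), Real.sqrt_mul (by positivity), Real.sqrt_sq (by linarith)]
  ring

end Regret

end MDPFamily

end IPSRL

end

theorem mainTheorem2 :
    ∃ C : ℝ, 0 < C ∧
      ∀ (Θ S A : Type*) [MeasurableSpace Θ] [Fintype S] [Fintype A] [Nonempty A] (H : ℕ)
        (M : IPSRL.MDPFamily Θ S A H) (μ₀ : MeasureTheory.Measure Θ)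
        [MeasureTheory.IsProbabilityMeasure μ₀] (π : M.OptimalSelection)
        (β : ℝ) (_ : 0 ≤ β) (L T : ℕ) (_ : 1 ≤ T),
        MeasureTheory.Integrable M.runRegret (M.runLaw β μ₀ π L T) ∧
        |M.bayesRegret β μ₀ π L T| ≤
          C * (√(M.misselectionProb β μ₀ π L * (H : ℝ) ^ 4 * (Fintype.card S : ℝ) ^ 2 *
            (Fintype.card A : ℝ) * (T : ℝ)) * (1 + Real.log T)) := by
  refine ⟨2 * √68, by positivity, ?_⟩
  intro Θ S A _ _ _ _ H M μ₀ _ π β _ L T hT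
  refine ⟨M.integrable_runRegret β μ₀ π L T, ?_⟩
  rw [abs_of_nonneg]
  · exact M.bayesRegret_le β μ₀ π L hT
  · rw [M.bayesRegret_eq_sum]
    exact Finset.sum_nonneg fun t _ => M.roundRegret_nonneg β μ₀ π L t
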